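/- Let $k$ be an algebraically closed field of characteristic zero. A \emph{rational ruled surface} is an irreducible algebraic surface $S\subset k^3$ such that through every point of $S$ there passes a line contained in $S$, and such that $S$ admits a rational parametrization, i.e. a dominant rational map $k^2\dashrightarrow S$. A parametrization of $S$ is \emph{in ruled form} if it is a dominant rational map $k^2\dashrightarrow S$ of the form \[ \mathcal P(s,t)=\left(\frac{r_1(s)+t\,p_1(s)}{q(s)},\frac{r_2(s)+t\,p_2(s)}{q(s)},\frac{r_3(s)+t\,p_3(s)}{q(s)}\right),\qquad r_i,p_i,q\in k[s],\ q\neq 0; \] it is a \emph{standardized ruled surface parametrization} if, moreover, those $p_i$ that are nonzero have the same degree and have no common root (and not all $p_i$ are zero). Every rational ruled surface $S$ admits a standardized ruled surface parametrization. Moreover, for every parametrization $\mathcal P$ of $S$ in ruled form there is a standardized ruled surface parametrization $\mathcal Q$ of $S$ that is obtained from $\mathcal P$ by successive changes of parameters of the forms $(s,t)\mapsto(s,\lambda s+\mu t)$, $(s,t)\mapsto\left(\frac{as+b}{cs+d},t\right)$ and $(s,t)\mapsto(s,t/\Delta(s))$, that is, \[ \mathcal Q(s,t)=\mathcal P\left(\sigma(s),\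 \lambda\,\sigma(s)+\mu\,\frac{t}{\Delta(s)}\right),\qquad \sigma(s)=\frac{as+b}{cs+d}, \] with $\lambda,\mu,a,b,c,d\in k$, $\mu\neq0$, $ad-bc\neq0$ and $0\neq\Delta\in k[s]$. -/

import Mathlib

namespace RuledSurface

open Polynomial

/-- A triple of rational functions in two variables, written over a common denominator;
it determines a rational map from the plane `k²` to the space `k³`. -/
structure PlaneMap (k : Type*) [Field k] where
  num : Fin 3 → MvPolynomial (Fin 2) k
  den : MvPolynomial (Fin 2) k
  den_ne_zero : den ≠ 0

namespace PlaneMap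

variable {k : Type*} [Field k]

/-- The value `P(a, b)`, for `a` and `b` in an arbitrary field extension of `k`. -/
noncomputable def evalAt (P : PlaneMap k) {L : Type*} [Field L] [Algebra k L] (a b : L) :
    Fin 3 → L :=
  fun i => MvPolynomial.aeval ![a, b] (P.num i) / MvPolynomial.aeval ![a, b] P.den

/-- The set of the points `P(a, b)` with `a, b ∈ k` at which the denominator does not vanish. -/
def image (P : PlaneMap k) : Set (Fin 3 → k) :=
  {x | ∃ a b : k, MvPolynomial.aeval ![a, b] P.den ≠ 0 ∧ x = P.evalAt a b}

/-- `P` is a parametrization of `S`, that is, a dominant rational map from `k²` to `S`: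
the Zariski closure of its image is `S`. -/
def Parametrizes (P : PlaneMap k) (S : Set (Fin 3 → k)) : Prop :=
  MvPolynomial.zeroLocus k (MvPolynomial.vanishingIdeal k P.image) = S

end PlaneMap

variable {k : Type*} [Field k]

/-- An irreducible algebraic surface in the affine space `k³`. -/
def IsSurface (S : Set (Fin 3 → k)) : Prop :=
  ∃ F : MvPolynomial (Fin 3) k, Irreducible F ∧ S = {x | MvPolynomial.eval x F = 0}

/-- Through every point of `S` there passes a line that is contained in `S`. -/
def IsRuled (S : Set (Fin 3 → k)) : Prop :=
  ∀ x ∈ S, ∃ v : Fin 3 → k, v ≠ 0 ∧ ∀ u : k, x + u • v ∈ S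

/-- `S` admits a rational parametrization. -/
def IsRational (S : Set (Fin 3 → k)) : Prop :=
  ∃ P : PlaneMap k, P.Parametrizes S

/-- A rational ruled surface in `k³`. -/
structure IsRationalRuledSurface (S : Set (Fin 3 → k)) : Prop where
  surface : IsSurface S
  ruled : IsRuled S
  rational : IsRational S

/-- The data of a triple of rational functions in ruled form,
`(s, t) ↦ ((rᵢ(s) + t pᵢ(s)) / q(s))` for `i = 1, 2, 3`. -/
structure RuledForm (k : Type*) [Field k] where
  r : Fin 3 → k[X]
  p : Fin 3 → k[X]
  q : k[X]
  q_ne_zero : q ≠ 0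

namespace RuledForm

/-- The rational map given by a triple in ruled form; the variables `0` and `1` are `s` and `t`. -/
noncomputable def toPlaneMap (P : RuledForm k) : PlaneMap k where
  num i := aeval (MvPolynomial.X 0) (P.r i) + MvPolynomial.X 1 * aeval (MvPolynomial.X 0) (P.p i)
  den := aeval (MvPolynomial.X 0) P.q
  den_ne_zero := by
    intro h
    exact P.q_ne_zero ((transcendental_iff.1 (MvPolynomial.transcendental_X k (0 : Fin 2))) _ h)

/-- `P` is a standardized ruled surface parametrization of `S`: it is a parametrization of `S`,
and those `pᵢ` that are nonzero have the same degree and no common root. (If all the `pᵢ` were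
zero, every element of `k` would be a common root, so the last condition excludes this.) -/
structure IsStandardized (P : RuledForm k) (S : Set (Fin 3 → k)) : Prop where
  parametrizes : P.toPlaneMap.Parametrizes S
  natDegree_eq : ∀ i j, P.p i ≠ 0 → P.p j ≠ 0 → (P.p i).natDegree = (P.p j).natDegree
  no_common_root : ¬ ∃ z : k, ∀ i, P.p i ≠ 0 → (P.p i).IsRoot z

end RuledForm

/-- The field `k(s, t)` of rational functions in two variables. -/
abbrev FunField (k : Type*) [Field k] : Type _ := FractionRing (MvPolynomial (Fin 2) k)

namespace FunField

variable (k)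

/-- The first parameter `s` as an element of `k(s, t)`. -/
noncomputable def s : FunField k := algebraMap (MvPolynomial (Fin 2) k) (FunField k) (.X 0)

/-- The second parameter `t` as an element of `k(s, t)`. -/
noncomputable def t : FunField k := algebraMap (MvPolynomial (Fin 2) k) (FunField k) (.X 1)

end FunField

/-- `Q` is obtained from `P` by successive changes of the parameters of the three forms
`(s, l s + m t)` with `m ≠ 0`, `((a s + b) / (c s + d), t)` with `a d - b c ≠ 0`, and
`(s, t / Δ(s))` with `Δ` a nonzero polynomial. -/
def IsReparametrization (Q P : PlaneMap k) : Prop :=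
  ∃ (l m a b c d : k) (Δ : k[X]), m ≠ 0 ∧ a * d - b * c ≠ 0 ∧ Δ ≠ 0 ∧
    ∃ σ τ : FunField k,
      σ = (a • FunField.s k + algebraMap k (FunField k) b) /
        (c • FunField.s k + algebraMap k (FunField k) d) ∧
      τ = l • σ + m • (FunField.t k / aeval (FunField.s k) Δ) ∧
      Q.evalAt (FunField.s k) (FunField.t k) = P.evalAt σ τ

end RuledSurface

/-!
Points with coordinates in `K = k(s, t)` replace the general points of the surface `F = 0`: a
rational map `P` parametrizes the surface if and only if `P(s, t)` is a generic point `ξ` of it.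

A line in the surface has an asymptotic direction, that is, an isotropic direction of the second
fundamental form `II` on the tangent plane; if `II` is nonzero at `ξ`, these are two directions
conjugate over the square root of the discriminant. The lines through the points of the surface
force one of the two directions at `ξ` to be that of a line in the surface over a field containing
the root. Either the root lies in `K`, and then the lines through the points `P(y)`, with `y` on a
general line of the plane, form a parametrization in ruled form; or both asymptotic directions at
every point are directions of lines in the surface, and then the lines of the second family along
one line of the first form such a parametrization. If `II` vanishes at `ξ`, then every derivation
of `K` maps the gradient at `ξ` to a multiple of itself, so the tangent plane has a constant
direction and the surface consists of parallel lines with a direction in `k³`.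

To standardize a parametrization in ruled form, move a parameter `s` at which no nonzero `pᵢ`
vanishes to infinity, which makes the degrees of these polynomials equal, and divide `t` by their
greatest common divisor.
-/

namespace RuledSurface

open scoped Polynomial

universe u

section GenericPoints

open MvPolynomial

/-- `ξ` is a generic point of the hypersurface `F = 0`, with coordinates in an extension of the
ground ring: the polynomials that vanish at `ξ` are exactly the multiples of `F`. -/
def IsGenericPoint {σ k L : Type*} [CommRing k] [CommRing L] [Algebra k L] (F : MvPolynomial σ k)
    (ξ : σ → L) : Prop :=
  ∀ G : MvPolynomial σ k, aeval ξ G = 0 ↔ F ∣ G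

variable {k : Type u} [Field k]

theorem FunField.aeval_s_t (g : MvPolynomial (Fin 2) k) :
    aeval ![FunField.s k, FunField.t k] g = algebraMap _ (FunField k) g := by
  have h : aeval ![FunField.s k, FunField.t k] =
      IsScalarTower.toAlgHom k (MvPolynomial (Fin 2) k) (FunField k) := by
    ext i
    fin_cases i <;> simp [FunField.s, FunField.t]
  rw [h, IsScalarTower.toAlgHom_apply]

theorem FunField.aeval_s_t_ne_zero {g : MvPolynomial (Fin 2) k} (hg : g ≠ 0) :
    aeval ![FunField.s k, FunField.t k] g ≠ 0 := by
  rw [aeval_s_t]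
  exact (map_ne_zero_iff _ (IsFractionRing.injective _ _)).2 hg

namespace PlaneMap

/-- The point `P(s, t)` with coordinates in `k(s, t)`. -/
noncomputable def generic (P : PlaneMap k) : Fin 3 → FunField k :=
  P.evalAt (FunField.s k) (FunField.t k)

theorem exists_aeval_evalAt_mul_pow (P : PlaneMap k) (G : MvPolynomial (Fin 3) k) :
    ∃ (g : MvPolynomial (Fin 2) k) (N : ℕ), ∀ (L : Type u) [Field L] [Algebra k L] (a b : L),
      aeval ![a, b] P.den ≠ 0 →
        aeval (P.evalAt a b) G * aeval ![a, b] P.den ^ N = aeval ![a, b] g := by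
  induction G using MvPolynomial.induction_on with
  | C c => exact ⟨C c, 0, fun L _ _ a b _ => by simp⟩
  | add p q hp hq =>
    obtain ⟨g, N, h⟩ := hp
    obtain ⟨g', N', h'⟩ := hq
    refine ⟨g * P.den ^ N' + g' * P.den ^ N, N + N', fun L _ _ a b hd => ?_⟩
    simp only [map_add, map_mul, map_pow, ← h L a b hd, ← h' L a b hd]
    ring
  | mul_X p i hp =>
    obtain ⟨g, N, h⟩ := hp
    refine ⟨g * P.num i, N + 1, fun L _ _ a b hd => ?_⟩
    have hi : P.evalAt a b i * aeval ![a, b] P.den = aeval ![a, b] (P.num i) :=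
      div_mul_cancel₀ _ hd
    simp only [map_mul, ← h L a b hd, ← hi, aeval_X]
    ring

theorem aeval_evalAt_eq_zero {P : PlaneMap k} {G : MvPolynomial (Fin 3) k}
    (h : aeval P.generic G = 0) {L : Type u} [Field L] [Algebra k L] {a b : L}
    (hd : aeval ![a, b] P.den ≠ 0) : aeval (P.evalAt a b) G = 0 := by
  obtain ⟨g, N, hg⟩ := P.exists_aeval_evalAt_mul_pow G
  have hg0 : aeval ![FunField.s k, FunField.t k] g = 0 := by
    rw [← hg _ _ _ (FunField.aeval_s_t_ne_zero P.den_ne_zero), ← generic, h, zero_mul]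
  have hg1 : g = 0 := of_not_not fun hne => FunField.aeval_s_t_ne_zero hne hg0
  have hmul := hg L a b hd
  rw [hg1, map_zero] at hmul
  exact (mul_eq_zero.1 hmul).resolve_right (pow_ne_zero _ hd)

theorem aeval_generic_eq_zero_of_dense [Infinite k] {P : PlaneMap k} {G : MvPolynomial (Fin 3) k}
    {h : MvPolynomial (Fin 2) k} (hh : h ≠ 0)
    (H : ∀ a b : k, aeval ![a, b] P.den ≠ 0 → aeval ![a, b] h ≠ 0 →
      aeval (P.evalAt a b) G = 0) :
    aeval P.generic G = 0 := by
  obtain ⟨g, N, hg⟩ := P.exists_aeval_evalAt_mul_pow G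
  have hgdh : g * (P.den * h) = 0 := by
    refine MvPolynomial.funext fun x => ?_
    have hx : ∀ f : MvPolynomial (Fin 2) k, eval x f = aeval ![x 0, x 1] f := fun f => by
      rw [aeval_eq_eval]
      congr 2
      ext i
      fin_cases i <;> rfl
    rw [map_zero, hx, map_mul, map_mul, mul_eq_zero, mul_eq_zero]
    by_contra! ⟨hgx, hdx, hhx⟩
    exact hgx (by rw [← hg k _ _ hdx, H _ _ hdx hhx, zero_mul])
  have hg0 : g = 0 := (mul_eq_zero.1 hgdh).resolve_right (mul_ne_zero P.den_ne_zero hh)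
  have hd := FunField.aeval_s_t_ne_zero P.den_ne_zero
  have hmul := hg _ _ _ hd
  rw [hg0, map_zero] at hmul
  exact (mul_eq_zero.1 hmul).resolve_right (pow_ne_zero _ hd)

theorem mem_vanishingIdeal_image_iff [Infinite k] {P : PlaneMap k} {G : MvPolynomial (Fin 3) k} :
    G ∈ vanishingIdeal k P.image ↔ aeval P.generic G = 0 := by
  rw [mem_vanishingIdeal_iff]
  constructor
  · intro h
    exact aeval_generic_eq_zero_of_dense (h := 1) one_ne_zero
      fun a b hd _ => h _ ⟨a, b, hd, rfl⟩
  · rintro h x ⟨a, b, hd, rfl⟩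
    exact aeval_evalAt_eq_zero h hd

theorem Parametrizes.congr [Infinite k] {P Q : PlaneMap k} {S : Set (Fin 3 → k)}
    (hP : P.Parametrizes S)
    (h : ∀ G : MvPolynomial (Fin 3) k, aeval Q.generic G = 0 ↔ aeval P.generic G = 0) :
    Q.Parametrizes S := by
  have hI : vanishingIdeal k Q.image = vanishingIdeal k P.image := by
    ext G
    rw [mem_vanishingIdeal_image_iff, mem_vanishingIdeal_image_iff, h]
  rw [Parametrizes, hI]
  exact hP

end PlaneMap

theorem dvd_of_forall_aeval_eq_zero [IsAlgClosed k] {σ : Type*} [Finite σ] {F G : MvPolynomial σ k}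
    (hF : Irreducible F) (h : ∀ x : σ → k, aeval x F = 0 → aeval x G = 0) : F ∣ G := by
  have hp : (Ideal.span {F}).IsPrime := (Ideal.span_singleton_prime hF.ne_zero).2 hF.prime
  rw [← Ideal.mem_span_singleton, ← IsPrime.vanishingIdeal_zeroLocus (K := k) (Ideal.span {F}),
    mem_vanishingIdeal_iff, zeroLocus_span]
  exact fun x hx => h x (hx F rfl)

namespace PlaneMap

theorem parametrizes_iff_isGenericPoint [IsAlgClosed k] {P : PlaneMap k}
    {F : MvPolynomial (Fin 3) k} (hF : Irreducible F) :
    P.Parametrizes {x | aeval x F = 0} ↔ IsGenericPoint F P.generic := by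
  constructor
  · intro hP G
    rw [← mem_vanishingIdeal_image_iff]
    constructor
    · intro h
      refine dvd_of_forall_aeval_eq_zero hF fun x hx => ?_
      have hx' : x ∈ {x | aeval x F = 0} := hx
      exact (hP ▸ hx') G h
    · rintro ⟨c, rfl⟩
      refine mem_vanishingIdeal_iff.2 fun x hx => ?_
      have hx' : x ∈ {x | aeval x F = 0} := hP ▸ zeroLocus_vanishingIdeal_le P.image hx
      rw [map_mul, show aeval x F = 0 from hx', zero_mul]
  · intro h
    ext x
    constructor
    · intro hx
      exact hx F (mem_vanishingIdeal_image_iff.2 ((h F).2 dvd_rfl))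
    · intro hx G hG
      obtain ⟨c, rfl⟩ := (h G).1 (mem_vanishingIdeal_image_iff.1 hG)
      rw [map_mul, show aeval x F = 0 from hx, zero_mul]

theorem exists_aeval_evalAt_ne_zero [Infinite k] {P : PlaneMap k} {G : MvPolynomial (Fin 3) k}
    (hG : aeval P.generic G ≠ 0) {h : MvPolynomial (Fin 2) k} (hh : h ≠ 0) :
    ∃ a b : k, aeval ![a, b] P.den ≠ 0 ∧ aeval ![a, b] h ≠ 0 ∧ aeval (P.evalAt a b) G ≠ 0 := by
  contrapose! hG
  exact aeval_generic_eq_zero_of_dense hh hG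

end PlaneMap

end GenericPoints

section AlgebraicIndependence

open MvPolynomial

variable {k : Type*} [Field k] {A B : Type*} [CommRing A] [CommRing B]
  [Algebra k A] [Algebra k B] {σ ι : Type*}

theorem algebraicIndependent_option_of_map [IsDomain A] (f : A →ₐ[k] B) {x : ι → A}
    (hx : AlgebraicIndependent k (fun i => f (x i))) {g : A} (hg : g ≠ 0) (hfg : f g = 0) :
    AlgebraicIndependent k (fun o : Option ι => o.elim g x) := by
  have hx' : AlgebraicIndependent k x := AlgebraicIndependent.of_comp f hx
  refine (hx'.option_iff_transcendental g).2 fun halg => ?_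
  -- A nonzero multiple `r = H(x)` of `g` lies in `k[x]`, and `f r = 0` forces `H = 0`.
  obtain ⟨⟨r, hr⟩, hr0, c, hc : r = g * c⟩ :=
    halg.exists_nonzero_dvd (mem_nonZeroDivisors_of_ne_zero hg)
  rw [Algebra.adjoin_range_eq_range_aeval] at hr
  obtain ⟨H, hH : aeval x H = r⟩ := hr
  have hHf : aeval (fun i => f (x i)) H = 0 := by
    rw [← comp_aeval_apply, hH, hc, map_mul, hfg, zero_mul]
  have hr_zero : r = 0 := by rw [← hH, algebraicIndependent_iff.1 hx H hHf, map_zero]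
  exact hr0 (Subtype.ext hr_zero)

theorem isGenericPoint_of_algebraicIndependent [Finite σ]
    {F : MvPolynomial σ k} (hF : Irreducible F) {ξ : σ → B} (h0 : aeval ξ F = 0) {e : ι → σ}
    (hξ : AlgebraicIndependent k (ξ ∘ e)) (hcard : Nat.card σ ≤ Nat.card ι + 1) :
    IsGenericPoint F ξ := by
  have hle : ∀ a ∈ Ideal.span {F}, aeval ξ a = 0 := by
    intro a ha
    obtain ⟨c, rfl⟩ := Ideal.mem_span_singleton.1 ha
    rw [map_mul, h0, zero_mul]
  refine fun G => ⟨fun hG => ?_, fun hG => hle G (Ideal.mem_span_singleton.2 hG)⟩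
  by_contra hFG
  -- Otherwise `F` and `G` could both be adjoined to the independent family.
  have hprime : (Ideal.span {F}).IsPrime := (Ideal.span_singleton_prime hF.ne_zero).2 hF.prime
  let f : MvPolynomial σ k →ₐ[k] MvPolynomial σ k ⧸ Ideal.span {F} := Ideal.Quotient.mkₐ k _
  have hf : ∀ a, f a = 0 ↔ F ∣ a := fun a =>
    Ideal.Quotient.eq_zero_iff_mem.trans Ideal.mem_span_singleton
  let φ : MvPolynomial σ k ⧸ Ideal.span {F} →ₐ[k] B := Ideal.Quotient.liftₐ _ (aeval ξ) hle
  have hφ : AlgebraicIndependent k fun i => φ (f (X (e i))) := by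
    have hφX : ∀ i, φ (f (X (e i))) = ξ (e i) := fun i => aeval_X ξ (e i)
    simpa only [hφX, Function.comp_def] using hξ
  have hfG := algebraicIndependent_option_of_map φ hφ (mt (hf G).1 hFG) hG
  have hfG' : AlgebraicIndependent k fun o : Option ι => f (o.elim G fun i => X (e i)) := by
    convert hfG using 2 with o
    cases o <;> rfl
  have hfF := algebraicIndependent_option_of_map f hfG' hF.ne_zero ((hf F).2 dvd_rfl)
  have := Fintype.ofFinite σ
  have : Finite ι := Finite.of_injective e fun i j hij => hξ.injective (congrArg ξ hij)
  have := Fintype.ofFinite ι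
  have htrdeg := hfF.lift_cardinalMk_le_trdeg
  rw [MvPolynomial.trdeg_of_isDomain] at htrdeg
  simp only [Cardinal.mk_fintype, Fintype.card_option, Nat.cast_add, Nat.cast_one,
    Cardinal.lift_add, Cardinal.lift_natCast, Cardinal.lift_one] at htrdeg
  norm_cast at htrdeg
  simp only [Nat.card_eq_fintype_card] at hcard
  omega

theorem IsGenericPoint.exists_algebraicIndependent {F : MvPolynomial σ k} (hF : Irreducible F)
    {ξ : σ → B} (hξ : IsGenericPoint F ξ) :
    ∃ l : σ, AlgebraicIndependent k fun i : {i // i ≠ l} => ξ i := by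
  obtain ⟨l, hl⟩ : F.vars.Nonempty := by
    by_contra! hv
    obtain ⟨c, rfl⟩ : ∃ c, F = C c := ⟨_, vars_eq_empty_iff_eq_C.1 hv⟩
    have hc : c ≠ 0 := fun hc => hF.ne_zero (by rw [hc, C_0])
    exact hF.not_isUnit ((IsUnit.mk0 c hc).map C)
  refine ⟨l, algebraicIndependent_iff.2 fun H hH => ?_⟩
  obtain ⟨c, hc⟩ : F ∣ rename (fun i : {i // i ≠ l} => i.1) H := by
    rw [← hξ, aeval_rename]
    exact hH
  by_contra hH0
  have hne : F * c ≠ 0 := hc ▸ fun h =>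
    hH0 (rename_injective _ Subtype.val_injective (by rw [h, map_zero]))
  have hvars : l ∉ (F * c).vars := fun hmem => by
    obtain ⟨i, -, hi⟩ := mem_vars_rename _ _ (hc ▸ hmem)
    exact i.2 hi
  rw [mem_vars_iff_degreeOf_ne_zero] at hl hvars
  rw [degreeOf_mul_eq hF.ne_zero (right_ne_zero_of_mul hne)] at hvars
  omega

theorem IsGenericPoint.exists_aeval_eq_zero [Finite σ] {F : MvPolynomial σ k}
    (hF : Irreducible F) {ξ : σ → B} (hξ : IsGenericPoint F ξ)
    {n : ℕ} (hA : Algebra.trdeg k A ≤ n) (hn : n + 1 < Nat.card σ) (η : σ → A) :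
    ∃ G : MvPolynomial σ k, aeval η G = 0 ∧ aeval ξ G ≠ 0 := by
  obtain ⟨l, hl⟩ := hξ.exists_algebraicIndependent hF
  have hη : ¬ AlgebraicIndependent k fun i : {i // i ≠ l} => η i := fun h => by
    have := Fintype.ofFinite σ
    classical
    have htrdeg := h.lift_cardinalMk_le_trdeg.trans (Cardinal.lift_le.2 hA)
    simp only [ne_eq, Cardinal.mk_fintype, Fintype.card_subtype_compl, Fintype.card_unique,
      Cardinal.lift_natCast, Nat.cast_le, tsub_le_iff_right] at htrdeg
    rw [Nat.card_eq_fintype_card] at hn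
    omega
  rw [algebraicIndependent_iff] at hη
  push Not at hη
  obtain ⟨H, hH, hH0⟩ := hη
  refine ⟨rename (fun i : {i // i ≠ l} => i.1) H, ?_, ?_⟩ <;> rw [aeval_rename]
  exacts [hH, fun h => hH0 (algebraicIndependent_iff.1 hl H h)]

end AlgebraicIndependence

section FamiliesOfLines

open MvPolynomial

variable {k : Type u} [Field k]

theorem FunField.transcendental_s : Transcendental k (FunField.s k) :=
  (transcendental_algebraMap_iff (IsFractionRing.injective _ _)).2 (transcendental_X k 0)

theorem FunField.aeval_s_injective :
    Function.Injective (Polynomial.aeval (FunField.s k) : k[X] →ₐ[k] FunField k) :=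
  transcendental_iff_injective.1 transcendental_s

namespace RuledForm

/-- The point with parameters `(a, t)`, for `a` and `t` in an arbitrary field extension of `k`. -/
noncomputable def point (Q : RuledForm k) {L : Type*} [Field L] [Algebra k L] (a t : L) :
    Fin 3 → L :=
  fun i => (Polynomial.aeval a (Q.r i) + t * Polynomial.aeval a (Q.p i)) / Polynomial.aeval a Q.q

theorem aeval_aeval_X_zero {L : Type*} [CommRing L] [Algebra k L] (a b : L) (f : k[X]) :
    aeval ![a, b] (Polynomial.aeval (X 0 : MvPolynomial (Fin 2) k) f) = Polynomial.aeval a f := by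
  rw [← Polynomial.aeval_algHom_apply, aeval_X, Matrix.cons_val_zero]

theorem aeval_den (Q : RuledForm k) {L : Type*} [CommRing L] [Algebra k L] (a b : L) :
    aeval ![a, b] Q.toPlaneMap.den = Polynomial.aeval a Q.q :=
  aeval_aeval_X_zero a b _

theorem evalAt_toPlaneMap (Q : RuledForm k) {L : Type*} [Field L] [Algebra k L] (a b : L) :
    Q.toPlaneMap.evalAt a b = Q.point a b := by
  ext i
  simp [PlaneMap.evalAt, point, toPlaneMap, aeval_aeval_X_zero]

theorem generic_toPlaneMap (Q : RuledForm k) :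
    Q.toPlaneMap.generic = Q.point (FunField.s k) (FunField.t k) :=
  Q.evalAt_toPlaneMap _ _

theorem aeval_point_eq_zero {Q : RuledForm k} {G : MvPolynomial (Fin 3) k}
    (h : aeval Q.toPlaneMap.generic G = 0) {L : Type u} [Field L] [Algebra k L] {a t : L}
    (hq : Polynomial.aeval a Q.q ≠ 0) : aeval (Q.point a t) G = 0 := by
  rw [← evalAt_toPlaneMap]
  exact PlaneMap.aeval_evalAt_eq_zero h (by rwa [aeval_den])

end RuledForm

theorem mem_range_algebraMap_of_aeval_eq_zero [IsAlgClosed k] {L : Type*} [Field L] [Algebra k L]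
    {x : L} {f : k[X]} (hf : f ≠ 0) (hx : Polynomial.aeval x f = 0) :
    x ∈ (algebraMap k L).range := by
  have hx' : IsIntegral k x := IsAlgebraic.isIntegral ⟨f, hf, hx⟩
  exact hx'.mem_range_algebraMap_of_minpoly_splits (IsAlgClosed.splits _)

theorem exists_aeval_ne_zero [Infinite k] {σ : Type*} {G : MvPolynomial σ k} (hG : G ≠ 0) :
    ∃ x : σ → k, aeval x G ≠ 0 := by
  contrapose! hG
  exact MvPolynomial.funext fun x => by simpa using hG x

theorem aeval_aeval_C_X {A : Type*} [CommRing A] [Algebra k A] (H : MvPolynomial (Fin 2) k)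
    (z : k) (y : A) :
    Polynomial.aeval y (aeval ![Polynomial.C z, Polynomial.X] H) =
      aeval ![algebraMap k A z, y] H := by
  rw [comp_aeval_apply]
  congr 2
  ext l
  fin_cases l <;> simp

theorem coeff_mem_range_of_forall_aeval_eq_zero [IsAlgClosed k] {L : Type*} [Field L] [Algebra k L]
    {H : MvPolynomial (Fin 2) k} (hH : H ≠ 0) {m n : L}
    (h : ∀ z : k, aeval ![algebraMap k L z, m * algebraMap k L z + n] H = 0) :
    m ∈ (algebraMap k L).range ∧ n ∈ (algebraMap k L).range := by
  have hmem : ∀ x : Fin 2 → k, aeval x H ≠ 0 →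
      m * algebraMap k L (x 0) + n ∈ (algebraMap k L).range := by
    intro x hx
    refine mem_range_algebraMap_of_aeval_eq_zero (fun h0 => hx ?_)
      ((aeval_aeval_C_X H (x 0) _).trans (h (x 0)))
    have hx' := aeval_aeval_C_X H (x 0) (x 1)
    rw [h0, map_zero] at hx'
    rw [hx', Algebra.algebraMap_self_apply]
    congr 2
    ext l
    fin_cases l <;> rfl
  obtain ⟨x, hx⟩ := exists_aeval_ne_zero hH
  have hX : X 0 - C (x 0) ≠ (0 : MvPolynomial (Fin 2) k) := fun h0 => by
    simpa using congrArg (eval fun _ => x 0 + 1) h0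
  obtain ⟨y, hy⟩ := exists_aeval_ne_zero (mul_ne_zero hH hX)
  rw [map_mul, mul_ne_zero_iff] at hy
  obtain ⟨hy, hxy⟩ := hy
  obtain ⟨c, hc⟩ := hmem x hx
  obtain ⟨d, hd⟩ := hmem y hy
  have hxy' : algebraMap k L (y 0) - algebraMap k L (x 0) ≠ 0 := by
    rw [← map_sub, map_ne_zero_iff _ (algebraMap k L).injective]
    simpa using hxy
  have hm : m = algebraMap k L ((d - c) / (y 0 - x 0)) := by
    rw [map_div₀, map_sub, map_sub, eq_div_iff hxy']
    linear_combination hc - hd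
  refine ⟨⟨_, hm.symm⟩, c - (d - c) / (y 0 - x 0) * x 0, ?_⟩
  rw [map_sub, map_mul, ← hm, hc]
  ring

theorem RuledForm.exists_projection_eq [IsAlgClosed k] {Q : RuledForm k} {i j : Fin 3}
    (hi : Q.p i ≠ 0) (h : ¬ AlgebraicIndependent k (Q.toPlaneMap.generic ∘ ![i, j])) :
    ∃ α γ : k, Q.p j = Polynomial.C γ * Q.p i ∧
      Q.r j = Polynomial.C γ * Q.r i + Polynomial.C α * Q.q := by
  rw [algebraicIndependent_iff] at h
  push Not at h
  obtain ⟨H, hH, hH0⟩ := h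
  rw [← aeval_rename] at hH
  let φ : k[X] →ₐ[k] FunField k := Polynomial.aeval (FunField.s k)
  have hφ : Function.Injective φ := FunField.aeval_s_injective
  have hp : φ (Q.p i) ≠ 0 := (map_ne_zero_iff _ hφ).2 hi
  have hq : φ Q.q ≠ 0 := (map_ne_zero_iff _ hφ).2 Q.q_ne_zero
  -- On the line with parameter `s`, the coordinate `j` is the affine function `m x + n` of the
  -- coordinate `i`.
  let m := φ (Q.p j) / φ (Q.p i)
  let n := (φ (Q.r j) - m * φ (Q.r i)) / φ Q.q
  have hmn : ∀ z : k, aeval ![algebraMap k _ z, m * algebraMap k _ z + n] H = 0 := by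
    intro z
    let t := (algebraMap k _ z * φ Q.q - φ (Q.r i)) / φ (Q.p i)
    have hvec : ![algebraMap k _ z, m * algebraMap k _ z + n] =
        Q.point (FunField.s k) t ∘ ![i, j] := by
      ext l
      fin_cases l
      · change algebraMap k _ z = (φ (Q.r i) + t * φ (Q.p i)) / φ Q.q
        simp only [t]
        field_simp
        ring
      · change m * algebraMap k _ z + n = (φ (Q.r j) + t * φ (Q.p j)) / φ Q.q
        simp only [t, m, n]
        field_simp
        ring
    rw [hvec, ← aeval_rename]
    exact aeval_point_eq_zero hH hq
  obtain ⟨⟨γ, hγ⟩, α, hα⟩ := coeff_mem_range_of_forall_aeval_eq_zero hH0 hmn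
  have hC : ∀ c : k, φ (Polynomial.C c) = algebraMap k (FunField k) c := Polynomial.aeval_C _
  refine ⟨α, γ, hφ ?_, hφ ?_⟩
  · rw [map_mul, hC, hγ, div_mul_cancel₀ _ hp]
  · rw [map_add, map_mul, map_mul, hC, hC, hα, hγ, div_mul_cancel₀ _ hq]
    ring

namespace RuledForm

theorem parametrizes_of_ne [IsAlgClosed k] {F : MvPolynomial (Fin 3) k} (hF : Irreducible F)
    {Q : RuledForm k} (hQ : ∀ a t : k, Q.q.eval a ≠ 0 → aeval (Q.point a t) F = 0) {a b t : k}
    (ha : Q.q.eval a ≠ 0) (hb : Q.q.eval b ≠ 0) {i : Fin 3} (hi : (Q.p i).eval a ≠ 0)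
    (hne : ∀ u, Q.point a u ≠ Q.point b t) :
    Q.toPlaneMap.Parametrizes {x | aeval x F = 0} := by
  have hFQ : aeval Q.toPlaneMap.generic F = 0 :=
    PlaneMap.aeval_generic_eq_zero_of_dense one_ne_zero fun a b hd _ => by
      rw [aeval_den, Polynomial.coe_aeval_eq_eval] at hd
      rw [evalAt_toPlaneMap]
      exact hQ a b hd
  rw [PlaneMap.parametrizes_iff_isGenericPoint hF]
  suffices ∃ j, AlgebraicIndependent k (Q.toPlaneMap.generic ∘ ![i, j]) by
    obtain ⟨j, hj⟩ := this
    exact isGenericPoint_of_algebraicIndependent hF hFQ hj (by simp)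
  -- Otherwise all the lines of the family coincide.
  by_contra! hdep
  choose α γ hp hr using fun j => exists_projection_eq (by rintro h0; simp [h0] at hi) (hdep j)
  refine hne ((Q.point b t i * Q.q.eval a - (Q.r i).eval a) / (Q.p i).eval a) (funext fun j => ?_)
  simp only [point, Polynomial.coe_aeval_eq_eval]
  rw [hp j, hr j]
  simp only [Polynomial.eval_add, Polynomial.eval_mul, Polynomial.eval_C]
  field_simp
  ring

theorem exists_p_ne_zero [IsAlgClosed k] {F : MvPolynomial (Fin 3) k} (hF : Irreducible F)
    {P : RuledForm k} (hP : P.toPlaneMap.Parametrizes {x | aeval x F = 0}) :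
    ∃ i, P.p i ≠ 0 := by
  by_contra! hp
  have htrdeg : Algebra.trdeg k (FractionRing k[X]) = 1 := by
    have := IsLocalization.isAlgebraic (FractionRing k[X]) (nonZeroDivisors k[X])
    rw [← trdeg_add_eq k k[X] (A := FractionRing k[X]), Polynomial.trdeg_of_isDomain,
      trdeg_eq_zero, add_zero]
  have hgen := (PlaneMap.parametrizes_iff_isGenericPoint hF).1 hP
  obtain ⟨G, hG, hG'⟩ := hgen.exists_aeval_eq_zero hF (n := 1) (by simp [htrdeg]) (by simp)
    fun i => algebraMap k[X] (FractionRing k[X]) (P.r i) / algebraMap k[X] _ P.q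
  let φ : FractionRing k[X] →ₐ[k] FunField k := IsFractionRing.liftAlgHom FunField.aeval_s_injective
  have hφ : ∀ f, φ (algebraMap k[X] _ f) = Polynomial.aeval (FunField.s k) f :=
    IsFractionRing.lift_algebraMap FunField.aeval_s_injective
  refine hG' ?_
  rw [← map_zero φ, ← hG, comp_aeval_apply]
  congr 2
  ext i
  simp [generic_toPlaneMap, point, hφ, hp]

end RuledForm

end FamiliesOfLines

section Reparametrization

open MvPolynomial

theorem algebraicIndependent_of_adjoin_eq_top {k K ι : Type*} [Field k] [Field K] [Algebra k K]
    [Finite ι] {x : ι → K} (hx : IntermediateField.adjoin k (Set.range x) = ⊤)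
    (hcard : (Nat.card ι : Cardinal) ≤ Algebra.trdeg k K) : AlgebraicIndependent k x := by
  have halg : Algebra.IsAlgebraic (Algebra.adjoin k (Set.range x)) K := by
    refine ⟨fun y => ?_⟩
    have hy : y ∈ IntermediateField.adjoin k (Set.range x) := hx ▸ IntermediateField.mem_top
    obtain ⟨f, hf, g, hg, rfl⟩ := IntermediateField.mem_adjoin_iff_div.1 hy
    rw [div_eq_mul_inv]
    lift f to Algebra.adjoin k (Set.range x) using hf
    lift g to Algebra.adjoin k (Set.range x) using hg
    exact (isAlgebraic_algebraMap f).mul (isAlgebraic_algebraMap g).inv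
  refine (Algebra.IsAlgebraic.isTranscendenceBasis_of_lift_le_trdeg_of_finite k x ?_).1
  rw [← Nat.cast_card, Cardinal.lift_natCast]
  exact Cardinal.nat_le_lift_iff.2 hcard

variable {k : Type u} [Field k]

theorem FunField.trdeg_eq_two : Algebra.trdeg k (FunField k) = 2 := by
  have := IsLocalization.isAlgebraic (FunField k) (nonZeroDivisors (MvPolynomial (Fin 2) k))
  rw [← trdeg_add_eq k (MvPolynomial (Fin 2) k) (A := FunField k), MvPolynomial.trdeg_of_isDomain,
    trdeg_eq_zero, add_zero, Cardinal.mk_fin, Cardinal.lift_natCast, Nat.cast_ofNat]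

theorem FunField.eq_top_of_mem {E : IntermediateField k (FunField k)} (hs : FunField.s k ∈ E)
    (ht : FunField.t k ∈ E) : E = ⊤ := by
  refine top_unique fun x _ => ?_
  have hE (f : MvPolynomial (Fin 2) k) : algebraMap _ (FunField k) f ∈ E := by
    have hst : Set.range ![FunField.s k, FunField.t k] ⊆ E := by
      simp [Set.insert_subset_iff, hs, ht]
    rw [← aeval_s_t]
    refine Algebra.adjoin_le (S := E.toSubalgebra) hst ?_
    rw [Algebra.adjoin_range_eq_range_aeval]
    exact ⟨f, rfl⟩
  obtain ⟨f, g, -, rfl⟩ := IsFractionRing.div_surjective (A := MvPolynomial (Fin 2) k) x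
  exact div_mem (hE f) (hE g)

theorem PlaneMap.Parametrizes.of_generic_eq_evalAt [Infinite k] {P Q : PlaneMap k}
    {S : Set (Fin 3 → k)} (hP : P.Parametrizes S) {σ τ : FunField k}
    (hστ : AlgebraicIndependent k ![σ, τ]) (hQ : Q.generic = P.evalAt σ τ) :
    Q.Parametrizes S := by
  let φ : FunField k →ₐ[k] FunField k := IsFractionRing.liftAlgHom hστ
  have hφ : ∀ f : MvPolynomial (Fin 2) k, φ (aeval ![FunField.s k, FunField.t k] f) =
      aeval ![σ, τ] f := fun f => by
    rw [FunField.aeval_s_t]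
    exact IsFractionRing.lift_algebraMap hστ f
  have hφP : Q.generic = fun i => φ (P.generic i) := by
    ext i
    rw [hQ, generic, evalAt, evalAt, map_div₀, hφ, hφ]
  refine hP.congr fun G => ?_
  rw [hφP, ← comp_aeval_apply]
  exact map_eq_zero_iff φ φ.injective

theorem FunField.smul_s_add_ne_zero {c d : k} (h : c ≠ 0 ∨ d ≠ 0) :
    c • FunField.s k + algebraMap k (FunField k) d ≠ 0 := by
  have hcd : Polynomial.C c * Polynomial.X + Polynomial.C d ≠ 0 := fun h0 => by
    have hc := congrArg (Polynomial.coeff · 1) h0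
    have hd := congrArg (Polynomial.coeff · 0) h0
    simp at hc hd
    tauto
  have := (map_ne_zero_iff _ (FunField.aeval_s_injective (k := k))).2 hcd
  simpa [Algebra.smul_def] using this

theorem IsReparametrization.parametrizes [Infinite k] {P Q : PlaneMap k} {S : Set (Fin 3 → k)}
    (h : IsReparametrization Q P) (hP : P.Parametrizes S) : Q.Parametrizes S := by
  obtain ⟨l, m, a, b, c, d, Δ, hm, habcd, hΔ, σ, τ, hσ, hτ, hQ⟩ := h
  let A := algebraMap k (FunField k)
  have hΔs : Polynomial.aeval (FunField.s k) Δ ≠ 0 :=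
    (map_ne_zero_iff _ FunField.aeval_s_injective).2 hΔ
  have hcd : c • FunField.s k + A d ≠ 0 := FunField.smul_s_add_ne_zero (by
    by_contra! h
    simp [h] at habcd)
  have habcd' : A a * A d - A b * A c ≠ 0 := by
    rwa [← map_mul, ← map_mul, ← map_sub, map_ne_zero_iff _ (algebraMap k (FunField k)).injective]
  rw [Algebra.smul_def] at hcd
  rw [Algebra.smul_def, Algebra.smul_def, eq_div_iff hcd] at hσ
  set E := IntermediateField.adjoin k (Set.range ![σ, τ])
  have hσE : σ ∈ E := IntermediateField.subset_adjoin _ _ ⟨0, rfl⟩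
  have hτE : τ ∈ E := IntermediateField.subset_adjoin _ _ ⟨1, rfl⟩
  have hsE : FunField.s k ∈ E := by
    have hne : A a - A c * σ ≠ 0 := fun h0 => habcd' <| by
      linear_combination (A c * FunField.s k + A d) * h0 + A c * hσ
    have hs : FunField.s k = (d • σ - A b) / (a • 1 - c • σ) := by
      rw [Algebra.smul_def, Algebra.smul_def, Algebra.smul_def, mul_one, eq_div_iff hne]
      linear_combination -hσ
    rw [hs]
    exact div_mem (sub_mem (E.smul_mem hσE) (E.algebraMap_mem b))
      (sub_mem (E.smul_mem E.one_mem) (E.smul_mem hσE))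
  have htE : FunField.t k ∈ E := by
    have hmt : m⁻¹ • (τ - l • σ) = FunField.t k / Polynomial.aeval (FunField.s k) Δ := by
      rw [hτ, add_sub_cancel_left, inv_smul_smul₀ hm]
    have hΔE : Polynomial.aeval (FunField.s k) Δ ∈ E := by
      exact Polynomial.aeval_algHom_apply E.val ⟨FunField.s k, hsE⟩ Δ ▸ SetLike.coe_mem _
    rw [← div_mul_cancel₀ (FunField.t k) hΔs, ← hmt]
    exact mul_mem (E.smul_mem (sub_mem hτE (E.smul_mem hσE))) hΔE
  refine hP.of_generic_eq_evalAt (algebraicIndependent_of_adjoin_eq_top ?_ ?_) hQ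
  · exact FunField.eq_top_of_mem hsE htE
  · simp [FunField.trdeg_eq_two]

end Reparametrization

section Standardization

open Polynomial

theorem exists_eq_mul_and_span_range_eq_top {R ι : Type*} [CommRing R] [IsDomain R]
    [IsPrincipalIdealRing R] {f : ι → R} (hf : ∃ i, f i ≠ 0) :
    ∃ (d : R) (g : ι → R), d ≠ 0 ∧ (∀ i, f i = d * g i) ∧ Ideal.span (Set.range g) = ⊤ := by
  obtain ⟨d, hd : Ideal.span (Set.range f) = Ideal.span {d}⟩ :=
    IsPrincipalIdealRing.principal (Ideal.span (Set.range f))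
  have hdvd : ∀ i, d ∣ f i := fun i =>
    Ideal.mem_span_singleton.1 (hd ▸ Ideal.subset_span (Set.mem_range_self i))
  choose g hg using hdvd
  have hd0 : d ≠ 0 := by
    rintro rfl
    obtain ⟨i, hi⟩ := hf
    exact hi (by rw [hg i, zero_mul])
  refine ⟨d, g, hd0, hg, ?_⟩
  have hmul : Ideal.span {d} * Ideal.span (Set.range g) = Ideal.span {d} * ⊤ := by
    rw [Ideal.span_mul_span', Ideal.mul_top, ← hd, Set.singleton_mul, ← Set.range_comp]
    congr 2
    ext i
    simp [hg]
  exact (Ideal.span_singleton_mul_right_injective hd0) hmul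

variable {k : Type u} [Field k]

theorem exists_forall_eval_ne_zero [Infinite k] {ι : Type*} [Finite ι] (f : ι → k[X]) :
    ∃ a : k, ∀ i, f i ≠ 0 → (f i).eval a ≠ 0 := by
  classical
  have := Fintype.ofFinite ι
  have hne : ∏ i with f i ≠ 0, f i ≠ 0 := Finset.prod_ne_zero_iff.2 (by simp)
  obtain ⟨a, ha⟩ := Polynomial.exists_eval_ne_zero_of_natDegree_lt_card _ hne
    (Cardinal.natCast_lt_aleph0.trans_le (Cardinal.aleph0_le_mk k))
  rw [eval_prod, Finset.prod_ne_zero_iff] at ha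
  exact ⟨a, fun i hi => ha i (by simpa using hi)⟩

/-- The polynomial `X ^ N * f (a + 1 / X)`, for `f` of degree at most `N`. -/
noncomputable def invert (N : ℕ) (a : k) (f : k[X]) : k[X] := (f.comp (X + C a)).reflect N

theorem aeval_invert {L : Type*} [Field L] [Algebra k L] {N : ℕ} (a : k) {f : k[X]}
    (hf : f.natDegree ≤ N) {z : L} (hz : z ≠ 0) :
    aeval z (invert N a f) = z ^ N * aeval (algebraMap k L a + z⁻¹) f := by
  let _ := invertibleOfNonzero (inv_ne_zero hz)
  have h := eval₂_reflect_mul_pow (algebraMap k L) z⁻¹ N (f.comp (X + C a))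
    (by rwa [natDegree_comp, natDegree_X_add_C, mul_one])
  have hcomp : eval₂ (algebraMap k L) z⁻¹ (f.comp (X + C a)) =
      aeval (algebraMap k L a + z⁻¹) f := by
    rw [← aeval_def, aeval_comp, map_add, aeval_X, aeval_C, add_comm]
  rw [invOf_eq_inv, inv_inv, hcomp] at h
  rw [← h, invert, aeval_def, mul_left_comm, ← mul_pow, mul_inv_cancel₀ hz, one_pow, mul_one]

theorem invert_eq_zero_iff {N : ℕ} {a : k} {f : k[X]} : invert N a f = 0 ↔ f = 0 := by
  rw [invert, reflect_eq_zero_iff, comp_X_add_C_eq_zero_iff]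

theorem natDegree_invert {N : ℕ} {a : k} {f : k[X]} (hf : f.natDegree ≤ N) (ha : f.eval a ≠ 0) :
    (invert N a f).natDegree = N := by
  refine le_antisymm (natDegree_reflect_le.trans ?_) (le_natDegree_of_ne_zero ?_)
  · rw [natDegree_comp, natDegree_X_add_C, mul_one]
    exact max_le le_rfl hf
  · rw [invert, coeff_reflect, revAt_le le_rfl, Nat.sub_self, coeff_zero_eq_eval_zero, eval_comp]
    simpa using ha

namespace RuledForm

theorem isReparametrization_of_invert {P Q : RuledForm k} {N : ℕ} {a : k} {Δ : k[X]} (hΔ : Δ ≠ 0)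
    (hNr : ∀ i, (P.r i).natDegree ≤ N) (hNp : ∀ i, (P.p i).natDegree ≤ N)
    (hNq : P.q.natDegree ≤ N) (hr : ∀ i, Q.r i = invert N a (P.r i))
    (hp : ∀ i, invert N a (P.p i) = Δ * Q.p i) (hq : Q.q = invert N a P.q) :
    IsReparametrization Q.toPlaneMap P.toPlaneMap := by
  let s := FunField.s k
  have hs : s ≠ 0 := by
    simpa using FunField.smul_s_add_ne_zero (k := k) (c := 1) (d := 0) (by simp)
  have hΔs : aeval s Δ ≠ 0 := (map_ne_zero_iff _ FunField.aeval_s_injective).2 hΔ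
  have hpoint : Q.point s (FunField.t k) =
      P.point (algebraMap k _ a + s⁻¹) (FunField.t k / aeval s Δ) := by
    ext i
    have hpi : aeval s (Q.p i) = s ^ N * aeval (algebraMap k _ a + s⁻¹) (P.p i) / aeval s Δ := by
      rw [← aeval_invert a (hNp i) hs, hp i, map_mul, mul_div_cancel_left₀ _ hΔs]
    simp only [point]
    rw [hr, hq, hpi, aeval_invert a (hNr i) hs, aeval_invert a hNq hs,
      ← mul_div_mul_left (_ + _ / _ * _) _ (pow_ne_zero N hs)]
    ring
  refine ⟨0, 1, a, 1, 1, 0, Δ, one_ne_zero, by simp, hΔ, _, _, rfl, rfl, ?_⟩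
  rw [evalAt_toPlaneMap, evalAt_toPlaneMap, hpoint]
  congr 1
  · rw [map_one, map_zero, one_smul, add_zero, Algebra.smul_def, add_div,
      mul_div_cancel_right₀ _ hs, one_div]
  · rw [zero_smul, zero_add, one_smul]

theorem exists_natDegree_le (P : RuledForm k) :
    ∃ N, (∀ i, (P.r i).natDegree ≤ N) ∧ (∀ i, (P.p i).natDegree ≤ N) ∧ P.q.natDegree ≤ N := by
  obtain ⟨m, hm⟩ := (Set.finite_range fun i => (P.r i).natDegree).bddAbove
  obtain ⟨n, hn⟩ := (Set.finite_range fun i => (P.p i).natDegree).bddAbove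
  refine ⟨m + n + P.q.natDegree, fun i => ?_, fun i => ?_, by omega⟩
  · have : (P.r i).natDegree ≤ m := hm ⟨i, rfl⟩
    omega
  · have : (P.p i).natDegree ≤ n := hn ⟨i, rfl⟩
    omega

theorem exists_isStandardized [Infinite k] {S : Set (Fin 3 → k)} {P : RuledForm k}
    (hP : P.toPlaneMap.Parametrizes S) (hp : ∃ i, P.p i ≠ 0) :
    ∃ Q : RuledForm k, Q.IsStandardized S ∧ IsReparametrization Q.toPlaneMap P.toPlaneMap := by
  obtain ⟨a, ha⟩ := exists_forall_eval_ne_zero P.p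
  obtain ⟨N, hNr, hNp, hNq⟩ := P.exists_natDegree_le
  obtain ⟨Δ, g, hΔ, hg, hspan⟩ := exists_eq_mul_and_span_range_eq_top
    (f := fun i => invert N a (P.p i)) (hp.imp fun i => mt invert_eq_zero_iff.1)
  let Q : RuledForm k :=
    ⟨fun i => invert N a (P.r i), g, invert N a P.q, mt invert_eq_zero_iff.1 P.q_ne_zero⟩
  have hQP : IsReparametrization Q.toPlaneMap P.toPlaneMap :=
    isReparametrization_of_invert hΔ hNr hNp hNq (fun _ => rfl) hg rfl
  have hdeg (i) (hi : g i ≠ 0) : Δ.natDegree + (g i).natDegree = N := by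
    have hpi : P.p i ≠ 0 := fun h0 => mul_ne_zero hΔ hi <| by rw [← hg, h0, invert_eq_zero_iff]
    rw [← natDegree_mul hΔ hi, ← hg, natDegree_invert (hNp i) (ha i hpi)]
  refine ⟨Q, ⟨hQP.parametrizes hP, fun i j hi hj => ?_, ?_⟩, hQP⟩
  · exact Nat.add_left_cancel ((hdeg i hi).trans (hdeg j hj).symm)
  · rintro ⟨z, hz⟩
    have hker : Ideal.span (Set.range g) ≤ RingHom.ker (evalRingHom z) := by
      rw [Ideal.span_le, Set.range_subset_iff]
      intro i
      by_cases hi : g i = 0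
      exacts [hi ▸ Ideal.zero_mem _, hz i hi]
    rw [hspan, top_le_iff] at hker
    exact RingHom.ker_ne_top _ hker

end RuledForm

end Standardization

section Lines

open MvPolynomial

theorem derivation_aeval {k σ A : Type*} [CommRing k] [Fintype σ] [CommRing A] [Algebra k A]
    (D : Derivation k A A) (y : σ → A) (G : MvPolynomial σ k) :
    D (aeval y G) = ∑ i, aeval y (pderiv i G) * D (y i) := by
  classical
  induction G using MvPolynomial.induction_on with
  | C c => simp
  | add p q hp hq => simp [hp, hq, add_mul, Finset.sum_add_distrib]
  | mul_X p i hp =>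
    have hX : ∀ j, aeval y (pderiv j (p * X i)) * D (y j) =
        (if j = i then aeval y p * D (y i) else 0) + y i * (aeval y (pderiv j p) * D (y j)) := by
      intro j
      rcases eq_or_ne j i with rfl | h
      · simp
        ring
      · simp [pderiv_X_of_ne h.symm, h]
        ring
    rw [Finset.sum_congr rfl fun j _ => hX j, Finset.sum_add_distrib, ← Finset.mul_sum, ← hp]
    simp

theorem pderiv_comm {k σ : Type*} [CommRing k] (i j : σ) (F : MvPolynomial σ k) :
    pderiv i (pderiv j F) = pderiv j (pderiv i F) := by
  classical
  have h : ⁅(pderiv i : Derivation k (MvPolynomial σ k) (MvPolynomial σ k)),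
      (pderiv j : Derivation k (MvPolynomial σ k) (MvPolynomial σ k))⁆ = 0 := by
    refine derivation_ext fun l => ?_
    simp only [Derivation.commutator_apply, pderiv_X, Pi.single_apply]
    split_ifs <;> simp
  simpa [Derivation.commutator_apply, sub_eq_zero] using congrArg (fun D => D F) h

section RestrictLine

variable {k σ L : Type*} [CommRing k] [CommRing L] [Algebra k L]

/-- The restriction of polynomials to the line `u ↦ x + u v`, as polynomials in `u`. -/
noncomputable def restrictLine (x v : σ → L) : MvPolynomial σ k →ₐ[k] L[X] :=
  aeval fun i => Polynomial.C (x i) + Polynomial.C (v i) * Polynomial.X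

theorem eval_restrictLine (x v : σ → L) (u : L) (G : MvPolynomial σ k) :
    (restrictLine x v G).eval u = aeval (x + u • v) G := by
  rw [← Polynomial.coe_aeval_eq_eval, ← AlgHom.restrictScalars_apply k (Polynomial.aeval u),
    restrictLine, comp_aeval_apply]
  congr 2
  ext i
  simp only [AlgHom.restrictScalars_apply, map_add, map_mul, Polynomial.aeval_C, Polynomial.aeval_X,
    Algebra.algebraMap_self_apply, Pi.add_apply, Pi.smul_apply, smul_eq_mul, mul_comm]

theorem restrictLine_eq_zero_iff {k : Type*} [Field k] [Infinite k] [IsDomain L] [Algebra k L]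
    {x v : σ → L} {G : MvPolynomial σ k} :
    restrictLine x v G = 0 ↔ ∀ u : k, aeval (x + u • v) G = 0 := by
  have heval : ∀ u : k, (restrictLine x v G).eval (algebraMap k L u) = aeval (x + u • v) G := by
    intro u
    rw [eval_restrictLine, algebraMap_smul]
  refine ⟨fun h u => by rw [← heval, h, Polynomial.eval_zero], fun h => ?_⟩
  refine Polynomial.eq_zero_of_infinite_isRoot _
    ((Set.infinite_range_of_injective (algebraMap k L).injective).mono ?_)
  rintro _ ⟨u, rfl⟩
  exact (heval u).trans (h u)

theorem derivative_restrictLine [Fintype σ] (x v : σ → L) (G : MvPolynomial σ k) :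
    Polynomial.derivative (restrictLine x v G) =
      ∑ i, restrictLine x v (pderiv i G) * Polynomial.C (v i) := by
  have h := derivation_aeval ((Polynomial.derivative' (R := L)).restrictScalars k)
    (fun i => Polynomial.C (x i) + Polynomial.C (v i) * Polynomial.X) G
  have hX : ∀ i, Polynomial.derivative (Polynomial.C (x i) + Polynomial.C (v i) * Polynomial.X) =
      Polynomial.C (v i) := fun i => by simp
  exact h.trans (Finset.sum_congr rfl fun i _ => congrArg (_ * ·) (hX i))

theorem sum_aeval_pderiv_mul_eq_zero [Fintype σ] {x v : σ → L} {G : MvPolynomial σ k}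
    (h : restrictLine x v G = 0) : ∑ i, aeval x (pderiv i G) * v i = 0 := by
  have h0 := congrArg (Polynomial.eval 0) (derivative_restrictLine x v G)
  simpa [h, Polynomial.eval_finsetSum, eval_restrictLine] using h0.symm

theorem sum_sum_aeval_pderiv_pderiv_mul_eq_zero [Fintype σ] {x v : σ → L}
    {G : MvPolynomial σ k} (h : restrictLine x v G = 0) :
    ∑ i, (∑ j, aeval x (pderiv j (pderiv i G)) * v j) * v i = 0 := by
  have hderiv : ∑ j, restrictLine x v (pderiv j G) * Polynomial.C (v j) = 0 := by
    rw [← derivative_restrictLine, h, Polynomial.derivative_zero]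
  simpa only [Polynomial.derivative_sum, Polynomial.derivative_mul, Polynomial.derivative_C,
    derivative_restrictLine, mul_zero, add_zero, Polynomial.eval_finsetSum, Polynomial.eval_mul,
    eval_restrictLine, zero_smul, Polynomial.eval_C, Polynomial.derivative_zero,
    Polynomial.eval_zero] using congrArg (fun f => (Polynomial.derivative f).eval 0) hderiv

theorem aeval_add_smul_of_sum_eq_zero [Fintype σ] [IsAddTorsionFree L] {v : σ → k}
    {G : MvPolynomial σ k} (h : ∑ i, C (v i) * pderiv i G = 0) (x : σ → L) (u : L) :
    aeval (x + u • algebraMap k L ∘ v) G = aeval x G := by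
  have hd : Polynomial.derivative (restrictLine x (algebraMap k L ∘ v) G) = 0 := by
    rw [derivative_restrictLine, ← map_zero (restrictLine (k := k) x (algebraMap k L ∘ v)), ← h,
      map_sum]
    refine Finset.sum_congr rfl fun i _ => ?_
    rw [map_mul, ← algebraMap_eq, AlgHom.commutes, mul_comm, Polynomial.algebraMap_apply]
    rfl
  rw [← eval_restrictLine, Polynomial.eq_C_of_derivative_eq_zero hd, Polynomial.eval_C,
    Polynomial.coeff_zero_eq_eval_zero, eval_restrictLine, zero_smul, add_zero]

end RestrictLine

section Degree

variable {k σ : Type*} [Field k]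

theorem totalDegree_pderiv_le (i : σ) (F : MvPolynomial σ k) :
    (pderiv i F).totalDegree ≤ F.totalDegree - 1 := by
  rw [totalDegree, Finset.sup_le_iff]
  intro m hm
  rw [mem_support_iff, coeff_pderiv] at hm
  have hF := le_totalDegree (mem_support_iff.2 (left_ne_zero_of_mul hm))
  rw [Finsupp.sum_add_index' (by simp) (by simp), Finsupp.sum_single_index rfl] at hF
  exact Nat.le_sub_one_of_lt hF

theorem pderiv_eq_zero_of_totalDegree_eq_zero {F : MvPolynomial σ k} (h : F.totalDegree = 0)
    (i : σ) : pderiv i F = 0 := by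
  rw [totalDegree_eq_zero_iff_eq_C.1 h, pderiv_C]

theorem sum_C_mul_pderiv_eq_zero_of_dvd [Fintype σ] {F : MvPolynomial σ k} {v : σ → k}
    (h : F ∣ ∑ i, C (v i) * pderiv i F) : ∑ i, C (v i) * pderiv i F = 0 := by
  by_contra hne
  have hdeg : (∑ i, C (v i) * pderiv i F).totalDegree ≤ F.totalDegree - 1 :=
    totalDegree_finsetSum_le fun i _ => by
      rw [C_mul']
      exact (totalDegree_smul_le _ _).trans (totalDegree_pderiv_le i F)
  have hle := (totalDegree_le_of_dvd_of_isDomain h hne).trans hdeg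
  refine hne (Finset.sum_eq_zero fun i _ => ?_)
  rw [pderiv_eq_zero_of_totalDegree_eq_zero (by omega), mul_zero]

theorem pderiv_eq_zero_of_dvd {F : MvPolynomial σ k} {i : σ} (h : F ∣ pderiv i F) :
    pderiv i F = 0 := by
  by_contra hne
  have hle := (totalDegree_le_of_dvd_of_isDomain h hne).trans (totalDegree_pderiv_le i F)
  exact hne (pderiv_eq_zero_of_totalDegree_eq_zero (by omega) i)

theorem eq_C_of_forall_pderiv_eq_zero [CharZero k] {F : MvPolynomial σ k}
    (h : ∀ i, pderiv i F = 0) : F = C (F.coeff 0) := by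
  classical
  ext m
  rw [coeff_C]
  split_ifs with hm
  · rw [hm]
  · obtain ⟨i, hi⟩ := Finsupp.ne_iff.1 (Ne.symm hm)
    have hcoeff := congrArg (coeff (m - Finsupp.single i 1)) (h i)
    rw [coeff_pderiv, coeff_zero, Finsupp.sub_add_single_one_cancel hi] at hcoeff
    exact (mul_eq_zero.1 hcoeff).resolve_right (Nat.cast_add_one_ne_zero _)

end Degree

end Lines

section RationalDirections

open MvPolynomial

variable {k : Type u} [Field k]

namespace PlaneMap

/-- The rational map `P + W`, for a triple `W` of polynomials. -/
noncomputable def translate (P : PlaneMap k) (W : Fin 3 → MvPolynomial (Fin 2) k) :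
    PlaneMap k where
  num i := P.num i + P.den * W i
  den := P.den
  den_ne_zero := P.den_ne_zero

theorem evalAt_translate {P : PlaneMap k} (W : Fin 3 → MvPolynomial (Fin 2) k) {L : Type*}
    [Field L] [Algebra k L] {a b : L} (h : aeval ![a, b] P.den ≠ 0) :
    (P.translate W).evalAt a b = P.evalAt a b + fun i => aeval ![a, b] (W i) := by
  ext i
  simp only [evalAt, translate, map_add, map_mul, Pi.add_apply, add_div,
    mul_div_cancel_left₀ _ h]

theorem generic_translate (P : PlaneMap k) (W : Fin 3 → MvPolynomial (Fin 2) k) :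
    (P.translate W).generic = P.generic + algebraMap _ (FunField k) ∘ W := by
  refine (evalAt_translate W (FunField.aeval_s_t_ne_zero P.den_ne_zero)).trans ?_
  exact congrArg (P.generic + ·) (funext fun i => FunField.aeval_s_t (W i))

theorem aeval_evalAt_add_smul_eq_zero {P : PlaneMap k} {F : MvPolynomial (Fin 3) k}
    {W : Fin 3 → MvPolynomial (Fin 2) k}
    (h : ∀ u : k, aeval (P.generic + u • algebraMap _ (FunField k) ∘ W) F = 0)
    {a b : k} (hd : aeval ![a, b] P.den ≠ 0) (u : k) :
    aeval (P.evalAt a b + u • fun i => aeval ![a, b] (W i)) F = 0 := by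
  have hgen : (P.translate (u • W)).generic = P.generic + u • algebraMap _ (FunField k) ∘ W := by
    rw [generic_translate]
    exact congrArg (P.generic + ·)
      (funext fun i => map_smul (IsScalarTower.toAlgHom k _ (FunField k)) u (W i))
  have hW : aeval ((P.translate (u • W)).evalAt a b) F = 0 :=
    aeval_evalAt_eq_zero (by rw [hgen, h]) hd
  rw [evalAt_translate _ hd] at hW
  rw [← hW]
  simp only [Pi.smul_apply, map_smul]
  rfl

theorem exists_forall_aeval_add_smul_eq_zero_of_ne_zero [Infinite k] {P : PlaneMap k}
    {F : MvPolynomial (Fin 3) k} {V : Fin 3 → FunField k} (hV : V ≠ 0)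
    (h : ∀ u : k, aeval (P.generic + u • V) F = 0) :
    ∃ W : Fin 3 → MvPolynomial (Fin 2) k, W ≠ 0 ∧
      ∀ u : k, aeval (P.generic + u • algebraMap _ (FunField k) ∘ W) F = 0 := by
  obtain ⟨⟨c, hc⟩, hcV⟩ := IsLocalization.exist_integer_multiples_of_finite
    (nonZeroDivisors (MvPolynomial (Fin 2) k)) V
  choose W hW using hcV
  have hc0 : algebraMap _ (FunField k) c ≠ 0 := by
    rw [← FunField.aeval_s_t]
    exact FunField.aeval_s_t_ne_zero (nonZeroDivisors.ne_zero hc)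
  have hWV : algebraMap _ (FunField k) ∘ W = algebraMap _ (FunField k) c • V :=
    funext fun i => (hW i).trans (Algebra.smul_def _ _)
  refine ⟨W, ?_, fun u => ?_⟩
  · rintro rfl
    refine hV ((smul_eq_zero.1 ?_).resolve_left hc0)
    rw [← hWV]
    exact funext fun _ => map_zero _
  · rw [hWV, ← algebraMap_smul (FunField k) u, smul_smul, ← eval_restrictLine,
      restrictLine_eq_zero_iff.2 h, Polynomial.eval_zero]

end PlaneMap

theorem IsGenericPoint.exists_forall_aeval_add_smul_eq_zero {F : MvPolynomial (Fin 3) k}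
    (hF : Irreducible F) {L : Type*} [CommRing L] [Algebra k L] {ξ : Fin 3 → L}
    (hξ : IsGenericPoint F ξ) (x v : Fin 3 → k) :
    ∃ G : MvPolynomial (Fin 3) k, (∀ u : k, aeval (x + u • v) G = 0) ∧ aeval ξ G ≠ 0 := by
  obtain ⟨G, hG, hG'⟩ := hξ.exists_aeval_eq_zero hF (n := 1)
    (Polynomial.trdeg_of_isDomain).le (by simp)
    fun i => Polynomial.C (x i) + Polynomial.C (v i) * Polynomial.X
  exact ⟨G, fun u => by rw [← eval_restrictLine, restrictLine, hG, Polynomial.eval_zero], hG'⟩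

namespace RuledForm

/-- The family of the lines through `P(y)` with the direction `W(y)`, where `y` runs over the line
through `p` and `p'` in the plane. -/
noncomputable def alongLine (P : PlaneMap k) (W : Fin 3 → MvPolynomial (Fin 2) k)
    (p p' : Fin 2 → k) (hp : aeval p P.den ≠ 0) : RuledForm k where
  r i := restrictLine p (p' - p) (P.num i)
  p i := restrictLine p (p' - p) (P.den * W i)
  q := restrictLine p (p' - p) P.den
  q_ne_zero h := hp <| by
    rw [← add_zero p, ← zero_smul k (p' - p), ← eval_restrictLine, h, Polynomial.eval_zero]

variable {P : PlaneMap k} {W : Fin 3 → MvPolynomial (Fin 2) k} {p p' : Fin 2 → k}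

theorem point_alongLine (hp : aeval p P.den ≠ 0) {a b z : k} (hy : p + z • (p' - p) = ![a, b])
    (hd : aeval ![a, b] P.den ≠ 0) (t : k) :
    (alongLine P W p p' hp).point z t = P.evalAt a b + t • fun i => aeval ![a, b] (W i) := by
  ext i
  simp only [point, alongLine, PlaneMap.evalAt, Polynomial.coe_aeval_eq_eval, eval_restrictLine, hy,
    map_mul, Pi.add_apply, Pi.smul_apply, smul_eq_mul]
  field_simp

theorem exists_parametrizes_of_forall_aeval_eq_zero [IsAlgClosed k]
    {F : MvPolynomial (Fin 3) k} (hF : Irreducible F) (hP : IsGenericPoint F P.generic)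
    (hW : W ≠ 0)
    (h : ∀ u : k, aeval (P.generic + u • algebraMap _ (FunField k) ∘ W) F = 0) :
    ∃ Q : RuledForm k, Q.toPlaneMap.Parametrizes {x | aeval x F = 0} := by
  obtain ⟨i, hi⟩ := Function.ne_iff.1 hW
  have hvec : ∀ y : Fin 2 → k, y = ![y 0, y 1] := fun y => List.ofFn_inj.1 rfl
  obtain ⟨p, hp⟩ := exists_aeval_ne_zero (mul_ne_zero P.den_ne_zero hi)
  have hpd : aeval p P.den ≠ 0 := fun h0 => hp (by rw [map_mul, h0, zero_mul])
  obtain ⟨G, hG, hPG⟩ := hP.exists_forall_aeval_add_smul_eq_zero hF (P.evalAt (p 0) (p 1))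
    fun i => aeval ![p 0, p 1] (W i)
  obtain ⟨a, b, hd, -, hG'⟩ := PlaneMap.exists_aeval_evalAt_ne_zero hPG one_ne_zero
  let Q := alongLine P W p ![a, b] hpd
  have hq : ∀ z, Q.q.eval z = aeval (p + z • (![a, b] - p)) P.den := fun z =>
    eval_restrictLine _ _ _ _
  have h₀ : p + (0 : k) • (![a, b] - p) = ![p 0, p 1] := by rw [zero_smul, add_zero, ← hvec]
  have h₁ : p + (1 : k) • (![a, b] - p) = ![a, b] := by rw [one_smul, add_sub_cancel]
  refine ⟨Q, parametrizes_of_ne hF (a := 0) (b := 1) (t := 0) (i := i) (fun z t hz => ?_) ?_ ?_ ?_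
    fun u hu => hG' ?_⟩
  · rw [hq, hvec (_ + _)] at hz
    rw [point_alongLine hpd (hvec _) hz]
    exact PlaneMap.aeval_evalAt_add_smul_eq_zero h hz t
  · rwa [hq, h₀, ← hvec]
  · rwa [hq, h₁]
  · exact ne_of_eq_of_ne (eval_restrictLine _ _ _ _) (by rwa [h₀, ← hvec])
  · rw [point_alongLine hpd h₀ (by rwa [← hvec]), point_alongLine hpd h₁ hd, zero_smul,
      add_zero] at hu
    rw [← hu, hG]

end RuledForm

theorem exists_ruledForm_of_forall_aeval_eq_zero [IsAlgClosed k]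
    {F : MvPolynomial (Fin 3) k} (hF : Irreducible F) {P : PlaneMap k}
    (hP : IsGenericPoint F P.generic) {V : Fin 3 → FunField k} (hV : V ≠ 0)
    (h : ∀ u : k, aeval (P.generic + u • V) F = 0) :
    ∃ Q : RuledForm k, Q.toPlaneMap.Parametrizes {x | aeval x F = 0} := by
  obtain ⟨W, hW, hPW⟩ := PlaneMap.exists_forall_aeval_add_smul_eq_zero_of_ne_zero hV h
  exact RuledForm.exists_parametrizes_of_forall_aeval_eq_zero hF hP hW hPW

end RationalDirections

section ConjugateDirections

open MvPolynomial

theorem exists_aeval_add_mul_eq {k σ : Type*} [CommRing k] (f g : σ → MvPolynomial σ k)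
    (D F : MvPolynomial σ k) :
    ∃ A B : MvPolynomial σ k, ∀ (L : Type u) [CommRing L] [Algebra k L] (x : σ → L) (e : L),
      e ^ 2 = aeval x D →
        aeval (fun i => aeval x (f i) + e * aeval x (g i)) F = aeval x A + e * aeval x B := by
  induction F using MvPolynomial.induction_on with
  | C c => exact ⟨C c, 0, fun L _ _ x e _ => by simp⟩
  | add p q hp hq =>
    obtain ⟨A, B, h⟩ := hp
    obtain ⟨A', B', h'⟩ := hq
    refine ⟨A + A', B + B', fun L _ _ x e he => ?_⟩
    rw [map_add, h L x e he, h' L x e he, map_add, map_add]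
    ring
  | mul_X p i hp =>
    obtain ⟨A, B, h⟩ := hp
    refine ⟨A * f i + D * B * g i, A * g i + B * f i, fun L _ _ x e he => ?_⟩
    simp only [map_mul, map_add, aeval_X, h L x e he, ← he]
    ring

/-- The value `f(x) + e g(x)` at `x` of the two-valued vector field `f + √D g`, where `e` is a
square root of `D(x)`. -/
noncomputable def twoValuedField {k σ L : Type*} [CommRing k] [CommRing L] [Algebra k L]
    (f g : σ → MvPolynomial σ k) (x : σ → L) (e : L) : σ → L :=
  fun i => aeval x (f i) + e * aeval x (g i)

variable {k : Type u} [Field k] {σ : Type*}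

theorem exists_aeval_add_smul_twoValuedField_eq (f g : σ → MvPolynomial σ k)
    (D F : MvPolynomial σ k) (u : k) :
    ∃ A B : MvPolynomial σ k, ∀ (L : Type u) [CommRing L] [Algebra k L] (x : σ → L) (e : L),
      e ^ 2 = aeval x D →
        aeval (x + u • twoValuedField f g x e) F = aeval x A + e * aeval x B := by
  obtain ⟨A, B, h⟩ := exists_aeval_add_mul_eq (fun i => X i + u • f i) (u • g) D F
  refine ⟨A, B, fun L _ _ x e he => ?_⟩
  rw [← h L x e he]
  congr 2
  ext i
  simp only [twoValuedField, Pi.add_apply, Pi.smul_apply, map_add, map_smul, aeval_X, smul_add,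
    mul_smul_comm, add_assoc]

theorem exists_sqrt_forall_add_mul_eq_zero_or {ι K : Type*} [Field K] {a b : ι → K} {d : K}
    (haa : ∀ i j, a i * a j = d * (b i * b j)) (hab : ∀ i j, a i * b j = a j * b i) :
    (∃ e, e ^ 2 = d ∧ ∀ i, a i + e * b i = 0) ∨ ∀ i, a i = 0 ∧ b i = 0 := by
  by_cases! hb : ∃ j, b j ≠ 0
  · obtain ⟨j, hj⟩ := hb
    refine .inl ⟨-(a j / b j), ?_, fun i => ?_⟩
    · field_simp
      linear_combination haa j j
    · field_simp
      linear_combination hab i j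
  · exact .inr fun i => ⟨by simpa only [hb, mul_zero, mul_self_eq_zero] using haa i i, hb i⟩

variable [IsAlgClosed k] [Finite σ] {F : MvPolynomial σ k}

theorem IsGenericPoint.aeval_eq_zero_of_forall {K : Type*} [CommRing K] [IsDomain K]
    [Algebra k K] {ξ : σ → K} (hF : Irreducible F) (hξ : IsGenericPoint F ξ)
    {G h : MvPolynomial σ k} (hh : aeval ξ h ≠ 0)
    (hG : ∀ x : σ → k, aeval x F = 0 → aeval x h ≠ 0 → aeval x G = 0) : aeval ξ G = 0 := by
  have hhG : aeval ξ (h * G) = 0 :=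
    (hξ _).2 (dvd_of_forall_aeval_eq_zero hF fun x hx => by
      rw [map_mul, mul_eq_zero, or_iff_not_imp_left]
      exact hG x hx)
  rw [map_mul] at hhG
  exact (mul_eq_zero.1 hhG).resolve_left hh

theorem IsGenericPoint.exists_sqrt_or_forall_aeval_twoValuedField_eq_zero {K : Type u} [Field K]
    [Algebra k K] {ξ : σ → K} (hF : Irreducible F) (hξ : IsGenericPoint F ξ)
    {f g : σ → MvPolynomial σ k} {D h : MvPolynomial σ k} (hh : aeval ξ h ≠ 0)
    (H : ∀ x : σ → k, aeval x F = 0 → aeval x h ≠ 0 →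
      ∃ e : k, e ^ 2 = aeval x D ∧ ∀ u : k, aeval (x + u • twoValuedField f g x e) F = 0) :
    (∃ e : K, e ^ 2 = aeval ξ D ∧ ∀ u : k, aeval (ξ + u • twoValuedField f g ξ e) F = 0) ∨
      ∀ (L : Type u) [Field L] [Algebra k L] (x : σ → L) (e : L), aeval x F = 0 →
        e ^ 2 = aeval x D → ∀ u : k, aeval (x + u • twoValuedField f g x e) F = 0 := by
  choose A B hAB using exists_aeval_add_smul_twoValuedField_eq f g D F
  have hx : ∀ x : σ → k, aeval x F = 0 → aeval x h ≠ 0 →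
      ∃ e : k, e ^ 2 = aeval x D ∧ ∀ u, aeval x (A u) + e * aeval x (B u) = 0 := fun x hx hxh => by
    obtain ⟨e, he, hline⟩ := H x hx hxh
    exact ⟨e, he, fun u => (hAB u k x e he).symm.trans (hline u)⟩
  -- Eliminating `e` from the equations `A u + e B u = 0` leaves polynomial equations in the point,
  -- which pass from the points of the hypersurface to `ξ`.
  have hAA : ∀ u v, aeval ξ (A u * A v - D * (B u * B v)) = 0 := fun u v =>
    hξ.aeval_eq_zero_of_forall hF hh fun x hxF hxh => by
      obtain ⟨e, he, hline⟩ := hx x hxF hxh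
      simp only [map_sub, map_mul, ← he]
      linear_combination aeval x (A v) * hline u - e * aeval x (B u) * hline v
  have hABBA : ∀ u v, aeval ξ (A u * B v - A v * B u) = 0 := fun u v =>
    hξ.aeval_eq_zero_of_forall hF hh fun x hxF hxh => by
      obtain ⟨e, -, hline⟩ := hx x hxF hxh
      simp only [map_sub, map_mul]
      linear_combination aeval x (B v) * hline u - aeval x (B u) * hline v
  simp only [map_sub, map_mul, sub_eq_zero] at hAA hABBA
  refine (exists_sqrt_forall_add_mul_eq_zero_or hAA hABBA).imp ?_ fun h0 L _ _ x e hxF he u => ?_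
  · rintro ⟨e, he, hline⟩
    exact ⟨e, he, fun u => (hAB u K ξ e he).trans (hline u)⟩
  · have hdvd : ∀ G, aeval ξ G = 0 → aeval x G = 0 := fun G hG => by
      obtain ⟨c, rfl⟩ := (hξ G).1 hG
      rw [map_mul, hxF, zero_mul]
    rw [hAB u L x e he, hdvd _ (h0 u).1, hdvd _ (h0 u).2, mul_zero, add_zero]

/-- On a line of the surface one may choose a square root of `D`; the lines in the direction of
the other value of the field sweep out the surface. -/
theorem exists_ruledForm_of_forall_aeval_twoValuedField_eq_zero {F : MvPolynomial (Fin 3) k}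
    (hF : Irreducible F) {f g : Fin 3 → MvPolynomial (Fin 3) k} {D r : MvPolynomial (Fin 3) k}
    (H : ∀ (x : Fin 3 → k) (e : k), aeval x F = 0 → e ^ 2 = aeval x D →
      ∀ u : k, aeval (x + u • twoValuedField f g x e) F = 0)
    {x v : Fin 3 → k} (hline : ∀ u : k, aeval (x + u • v) F = 0)
    (hr : ∀ u : k, aeval (x + u • v) r ^ 2 = aeval (x + u • v) D)
    (hne : twoValuedField f g x (-aeval x r) ≠ 0)
    (hv : ∀ u : k, u • twoValuedField f g x (-aeval x r) ≠ v) :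
    ∃ Q : RuledForm k, Q.toPlaneMap.Parametrizes {x | aeval x F = 0} := by
  let Q : RuledForm k :=
    { r := fun i => restrictLine (k := k) x v (X i)
      p := fun i => restrictLine x v (f i - r * g i)
      q := 1
      q_ne_zero := one_ne_zero }
  have hp : ∀ i z, (Q.p i).eval z =
      twoValuedField f g (x + z • v) (-aeval (x + z • v) r) i := fun i z => by
    rw [show Q.p i = restrictLine x v (f i - r * g i) from rfl, eval_restrictLine, map_sub, map_mul,
      twoValuedField, neg_mul, sub_eq_add_neg]
  have hpoint : ∀ z t : k, Q.point z t =
      (x + z • v) + t • twoValuedField f g (x + z • v) (-aeval (x + z • v) r) := fun z t => by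
    ext i
    rw [Pi.add_apply, Pi.smul_apply, ← hp]
    simp [RuledForm.point, Q, Polynomial.coe_aeval_eq_eval, eval_restrictLine]
  obtain ⟨i, hi⟩ := Function.ne_iff.1 hne
  refine ⟨Q, RuledForm.parametrizes_of_ne hF (a := 0) (b := 1) (t := 0) (i := i)
    (fun z t _ => ?_) (by simp [Q]) (by simp [Q]) (by simpa [hp] using hi) fun u hu => ?_⟩
  · rw [hpoint]
    exact H _ _ (hline z) (by rw [neg_sq, hr]) t
  · refine hv u ?_
    simpa [hpoint] using hu

end ConjugateDirections

section SecondFundamentalForm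

open Matrix

section CommRing

variable {A : Type*} [CommRing A] (n : Fin 3 → A) (H : Matrix (Fin 3) (Fin 3) A)

/-- The second fundamental form, up to a nonzero factor, of a surface at a point where its
equation has the gradient `n` and the Hessian matrix `H`. The tangent plane is parametrized by
`a ↦ a × n`, so that no tangent frame has to be chosen. -/
noncomputable def secondForm : LinearMap.BilinForm A (Fin 3 → A) :=
  (Matrix.toBilin' H).comp (crossProduct.flip n) (crossProduct.flip n)

/-- The negative of the Gram determinant of `a` and `b` for the second fundamental form. -/
noncomputable def secondDisc (a b : Fin 3 → A) : A :=
  secondForm n H a b ^ 2 - secondForm n H a a * secondForm n H b b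

/-- If `e` is a square root of the discriminant, then this is an asymptotic direction, that is,
an isotropic vector of the second fundamental form. -/
noncomputable def asymptoticDirection (a b : Fin 3 → A) (e : A) : Fin 3 → A :=
  (e - secondForm n H a b) • (a ⨯₃ n) + secondForm n H a a • (b ⨯₃ n)

theorem secondForm_apply (a b : Fin 3 → A) :
    secondForm n H a b = (a ⨯₃ n) ⬝ᵥ H *ᵥ (b ⨯₃ n) :=
  Matrix.toBilin'_apply' H (a ⨯₃ n) (b ⨯₃ n)

theorem secondForm_comm {H : Matrix (Fin 3) (Fin 3) A} (hH : H.IsSymm) (a b : Fin 3 → A) :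
    secondForm n H a b = secondForm n H b a := by
  rw [secondForm_apply, secondForm_apply, dotProduct_mulVec, ← mulVec_transpose, hH.eq,
    dotProduct_comm]

theorem asymptoticDirection_dotProduct_left (a b : Fin 3 → A) (e : A) :
    asymptoticDirection n H a b e ⬝ᵥ a = secondForm n H a a * n ⬝ᵥ (a ⨯₃ b) := by
  simp only [asymptoticDirection, add_dotProduct, smul_dotProduct, smul_eq_mul, cross_apply,
    vec3_dotProduct, cons_val]
  ring

theorem asymptoticDirection_dotProduct_right (a b : Fin 3 → A) (e : A) :
    asymptoticDirection n H a b e ⬝ᵥ b = -(e - secondForm n H a b) * n ⬝ᵥ (a ⨯₃ b) := by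
  simp only [asymptoticDirection, add_dotProduct, smul_dotProduct, smul_eq_mul, cross_apply,
    vec3_dotProduct, cons_val]
  ring

theorem dotProduct_cross_smul_eq {n v : Fin 3 → A} (hv : n ⬝ᵥ v = 0) (a b : Fin 3 → A) :
    (n ⬝ᵥ (a ⨯₃ b)) • v = ((v ⬝ᵥ a) • b - (v ⬝ᵥ b) • a) ⨯₃ n := by
  rw [dotProduct_comm v a, dotProduct_comm v b, ← cross_cross_eq_smul_sub_smul,
    cross_cross_eq_smul_sub_smul, dotProduct_comm v n, hv, zero_smul, sub_zero, dotProduct_comm n]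

theorem secondForm_eq_zero_of_isotropic {n v : Fin 3 → A} {H : Matrix (Fin 3) (Fin 3) A}
    (hH : H.IsSymm) (hnv : n ⬝ᵥ v = 0) (hv : v ⬝ᵥ H *ᵥ v = 0) (a b : Fin 3 → A) :
    (v ⬝ᵥ a) ^ 2 * secondForm n H b b - 2 * (v ⬝ᵥ a) * (v ⬝ᵥ b) * secondForm n H a b +
      (v ⬝ᵥ b) ^ 2 * secondForm n H a a = 0 := by
  have h : secondForm n H ((v ⬝ᵥ a) • b - (v ⬝ᵥ b) • a) ((v ⬝ᵥ a) • b - (v ⬝ᵥ b) • a) = 0 := by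
    rw [secondForm_apply, ← dotProduct_cross_smul_eq hnv, mulVec_smul, dotProduct_smul,
      smul_dotProduct, hv, smul_zero, smul_zero]
  simp only [map_sub, map_smul, LinearMap.sub_apply, LinearMap.smul_apply, smul_eq_mul,
    secondForm_comm n hH b a] at h
  linear_combination h

theorem map_secondForm {B : Type*} [CommRing B] (φ : A →+* B) (a b : Fin 3 → A) :
    φ (secondForm n H a b) = secondForm (φ ∘ n) (H.map φ) (φ ∘ a) (φ ∘ b) := by
  have hcross : ∀ c : Fin 3 → A, φ ∘ (c ⨯₃ n) = (φ ∘ c) ⨯₃ (φ ∘ n) := fun c => by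
    ext i
    fin_cases i <;> simp [cross_apply]
  simp only [secondForm_apply, RingHom.map_dotProduct, ← hcross]
  congr 1
  ext i
  exact RingHom.map_mulVec φ H _ i

end CommRing

section Field

variable {L : Type*} [Field L] {n v a b : Fin 3 → L} {H : Matrix (Fin 3) (Fin 3) L}

theorem dotProduct_ne_zero_of_isotropic (hH : H.IsSymm) (hnv : n ⬝ᵥ v = 0) (hv : v ⬝ᵥ H *ᵥ v = 0)
    (hv0 : v ≠ 0) (hab : n ⬝ᵥ (a ⨯₃ b) ≠ 0) (ha : secondForm n H a a ≠ 0) : v ⬝ᵥ a ≠ 0 := by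
  intro hva
  have hvb : v ⬝ᵥ b = 0 := by
    have h := secondForm_eq_zero_of_isotropic hH hnv hv a b
    rw [hva] at h
    simpa [ha] using h
  have h := dotProduct_cross_smul_eq hnv a b
  rw [hva, hvb, zero_smul, zero_smul, sub_zero, map_zero, LinearMap.zero_apply] at h
  exact hv0 ((smul_eq_zero.1 h).resolve_left hab)

theorem sq_eq_secondDisc_of_isotropic (hH : H.IsSymm) (hnv : n ⬝ᵥ v = 0) (hv : v ⬝ᵥ H *ᵥ v = 0)
    (hva : v ⬝ᵥ a ≠ 0) :
    (secondForm n H a b - (v ⬝ᵥ b) / (v ⬝ᵥ a) * secondForm n H a a) ^ 2 = secondDisc n H a b := by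
  have h := secondForm_eq_zero_of_isotropic hH hnv hv a b
  rw [secondDisc]
  field_simp
  linear_combination secondForm n H a a * h

theorem asymptoticDirection_eq_smul (hnv : n ⬝ᵥ v = 0) (hva : v ⬝ᵥ a ≠ 0) :
    asymptoticDirection n H a b
        (secondForm n H a b - (v ⬝ᵥ b) / (v ⬝ᵥ a) * secondForm n H a a) =
      (secondForm n H a a * (n ⬝ᵥ (a ⨯₃ b)) / (v ⬝ᵥ a)) • v := by
  rw [mul_div_right_comm, mul_smul, dotProduct_cross_smul_eq hnv, asymptoticDirection]
  simp only [map_sub, map_smul, LinearMap.sub_apply, LinearMap.smul_apply]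
  match_scalars
  · field_simp
    ring
  · field_simp

theorem asymptoticDirection_ne_zero (ha : secondForm n H a a ≠ 0) (hab : n ⬝ᵥ (a ⨯₃ b) ≠ 0)
    (e : L) : asymptoticDirection n H a b e ≠ 0 := by
  intro h
  have hdot := asymptoticDirection_dotProduct_left n H a b e
  rw [h, zero_dotProduct] at hdot
  exact mul_ne_zero ha hab hdot.symm

theorem eq_of_asymptoticDirection_eq_smul (ha : secondForm n H a a ≠ 0)
    (hab : n ⬝ᵥ (a ⨯₃ b) ≠ 0) {e e' c : L}
    (h : asymptoticDirection n H a b e = c • asymptoticDirection n H a b e') : e = e' := by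
  have hleft := congrArg (· ⬝ᵥ a) h
  have hright := congrArg (· ⬝ᵥ b) h
  simp only [smul_dotProduct, asymptoticDirection_dotProduct_left,
    asymptoticDirection_dotProduct_right, smul_eq_mul] at hleft hright
  obtain rfl : c = 1 := (mul_eq_right₀ (mul_ne_zero ha hab)).1 hleft.symm
  rw [one_mul] at hright
  exact sub_left_injective (neg_injective (mul_right_cancel₀ hab hright))

end Field

end SecondFundamentalForm

section AsymptoticLines

open MvPolynomial Matrix

section Gradient

variable {k σ L L' : Type*} [CommRing k] [CommRing L] [Algebra k L] [CommRing L'] [Algebra k L']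

/-- The gradient of `F` at the point `x`. -/
noncomputable def gradient (F : MvPolynomial σ k) (x : σ → L) : σ → L :=
  fun i => aeval x (pderiv i F)

/-- The Hessian matrix of `F` at the point `x`. -/
noncomputable def hessian (F : MvPolynomial σ k) (x : σ → L) : Matrix σ σ L :=
  .of fun i j => aeval x (pderiv j (pderiv i F))

theorem hessian_isSymm (F : MvPolynomial σ k) (x : σ → L) : (hessian F x).IsSymm :=
  IsSymm.ext fun i j => congrArg (aeval x) (pderiv_comm i j F)

theorem map_gradient (φ : L →ₐ[k] L') (F : MvPolynomial σ k) (x : σ → L) :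
    φ ∘ gradient F x = gradient F (φ ∘ x) :=
  funext fun _ => comp_aeval_apply x φ _

theorem map_hessian (φ : L →ₐ[k] L') (F : MvPolynomial σ k) (x : σ → L) :
    (hessian F x).map φ = hessian F (φ ∘ x) :=
  Matrix.ext fun _ _ => comp_aeval_apply x φ _

theorem gradient_dotProduct_eq_zero [Fintype σ] {F : MvPolynomial σ k} {x v : σ → L}
    (h : restrictLine x v F = 0) : gradient F x ⬝ᵥ v = 0 :=
  sum_aeval_pderiv_mul_eq_zero h

theorem dotProduct_hessian_mulVec_eq_zero [Fintype σ] {F : MvPolynomial σ k} {x v : σ → L}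
    (h : restrictLine x v F = 0) : v ⬝ᵥ hessian F x *ᵥ v = 0 := by
  rw [dotProduct_comm]
  exact sum_sum_aeval_pderiv_pderiv_mul_eq_zero h

end Gradient

section Polynomials

variable {k : Type*} [CommRing k] (F : MvPolynomial (Fin 3) k) (a b : Fin 3 → k)

/-- The second fundamental form of the surface `F = 0` at constant vectors, as a polynomial in the
point of the surface. -/
noncomputable def secondFormPoly : MvPolynomial (Fin 3) k :=
  secondForm (gradient F X) (hessian F X) (C ∘ a) (C ∘ b)

/-- The discriminant of the second fundamental form, as a polynomial in the point. -/
noncomputable def secondDiscPoly : MvPolynomial (Fin 3) k :=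
  secondFormPoly F a b ^ 2 - secondFormPoly F a a * secondFormPoly F b b

/-- The two asymptotic directions at the points of the surface `F = 0`; the argument `e` is a square
root of the value of `secondDiscPoly F a b` at the point. -/
noncomputable abbrev asymptoticField {L : Type*} [CommRing L] [Algebra k L] :
    (Fin 3 → L) → L → Fin 3 → L :=
  twoValuedField (asymptoticDirection (gradient F X) (hessian F X) (C ∘ a) (C ∘ b) 0)
    ((C ∘ a) ⨯₃ gradient F X)

variable {L : Type*} [CommRing L] [Algebra k L] (x : Fin 3 → L)

theorem aeval_secondFormPoly :
    aeval x (secondFormPoly F a b) =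
      secondForm (gradient F x) (hessian F x) (algebraMap k L ∘ a) (algebraMap k L ∘ b) := by
  have hX : (aeval x : _ →ₐ[k] L) ∘ (X : Fin 3 → MvPolynomial (Fin 3) k) = x := by
    ext i
    simp
  have hC : ∀ a : Fin 3 → k, (aeval x : _ →ₐ[k] L) ∘ C ∘ a = algebraMap k L ∘ a := fun a => by
    ext i
    simp
  have h := map_secondForm (gradient F X) (hessian F X) (aeval x : _ →ₐ[k] L).toRingHom
    (C ∘ a) (C ∘ b)
  simpa [secondFormPoly, map_gradient, map_hessian, hX, hC] using h

theorem aeval_secondDiscPoly :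
    aeval x (secondDiscPoly F a b) =
      secondDisc (gradient F x) (hessian F x) (algebraMap k L ∘ a) (algebraMap k L ∘ b) := by
  simp only [secondDiscPoly, secondDisc, map_sub, map_mul, map_pow, aeval_secondFormPoly]

theorem asymptoticField_apply (e : L) :
    asymptoticField F a b x e = asymptoticDirection (gradient F x) (hessian F x)
      (algebraMap k L ∘ a) (algebraMap k L ∘ b) e := by
  have hcross : ∀ (c : Fin 3 → k) i, aeval x (((C ∘ c) ⨯₃ gradient F X) i) =
      ((algebraMap k L ∘ c) ⨯₃ gradient F x) i := fun c i => by
    fin_cases i <;> simp [cross_apply, gradient]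
  ext i
  have h := fun c => aeval_secondFormPoly F a c x
  simp only [secondFormPoly] at h
  simp only [asymptoticField, twoValuedField, asymptoticDirection, Pi.add_apply, Pi.smul_apply,
    smul_eq_mul, map_add, map_mul, map_sub, map_zero, hcross, h]
  ring

end Polynomials

end AsymptoticLines

section AsymptoticRulings

open MvPolynomial Matrix

theorem restrictLine_add_smul_eq_zero {k σ L : Type*} [Field k] [Infinite k] [CommRing L]
    [IsDomain L] [Algebra k L] {x v : σ → L} {F : MvPolynomial σ k} (h : restrictLine x v F = 0)
    (z : k) : restrictLine (x + z • v) v F = 0 := by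
  rw [restrictLine_eq_zero_iff] at h ⊢
  intro u
  rw [add_assoc, ← add_smul]
  exact h _

theorem aeval_gradient_dotProduct_cross {k L : Type*} [CommRing k] [CommRing L] [Algebra k L]
    (F : MvPolynomial (Fin 3) k) (a b : Fin 3 → k) (x : Fin 3 → L) :
    aeval x (gradient F X ⬝ᵥ ((C ∘ a) ⨯₃ (C ∘ b))) =
      gradient F x ⬝ᵥ ((algebraMap k L ∘ a) ⨯₃ (algebraMap k L ∘ b)) := by
  simp only [dotProduct, Fin.sum_univ_three, cross_apply, gradient, cons_val, aeval_X_left_apply,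
    Function.comp_apply, map_add, map_sub, map_mul, aeval_C]

section Field

variable {k L : Type*} [Field k] [Field L] [Algebra k L] {F : MvPolynomial (Fin 3) k}
  {a b : Fin 3 → k} {x v : Fin 3 → L}

theorem sq_eq_aeval_secondDiscPoly (h : restrictLine x v F = 0)
    (hva : v ⬝ᵥ (algebraMap k L ∘ a) ≠ 0) :
    (aeval x (secondFormPoly F a b) - (v ⬝ᵥ (algebraMap k L ∘ b)) / (v ⬝ᵥ (algebraMap k L ∘ a)) *
      aeval x (secondFormPoly F a a)) ^ 2 = aeval x (secondDiscPoly F a b) := by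
  simp only [aeval_secondFormPoly, aeval_secondDiscPoly]
  exact sq_eq_secondDisc_of_isotropic (hessian_isSymm F x) (gradient_dotProduct_eq_zero h)
    (dotProduct_hessian_mulVec_eq_zero h) hva

theorem exists_asymptoticField_eq_smul (h : restrictLine x v F = 0)
    (hva : v ⬝ᵥ (algebraMap k L ∘ a) ≠ 0) :
    ∃ c : L, asymptoticField F a b x (aeval x (secondFormPoly F a b) -
      (v ⬝ᵥ (algebraMap k L ∘ b)) / (v ⬝ᵥ (algebraMap k L ∘ a)) *
        aeval x (secondFormPoly F a a)) = c • v := by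
  simp only [aeval_secondFormPoly, asymptoticField_apply]
  exact ⟨_, asymptoticDirection_eq_smul (gradient_dotProduct_eq_zero h) hva⟩

theorem dotProduct_ne_zero_of_restrictLine_eq_zero (h : restrictLine x v F = 0) (hv : v ≠ 0)
    (ha : aeval x (secondFormPoly F a a) ≠ 0)
    (hab : gradient F x ⬝ᵥ ((algebraMap k L ∘ a) ⨯₃ (algebraMap k L ∘ b)) ≠ 0) :
    v ⬝ᵥ (algebraMap k L ∘ a) ≠ 0 :=
  dotProduct_ne_zero_of_isotropic (hessian_isSymm F x) (gradient_dotProduct_eq_zero h)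
    (dotProduct_hessian_mulVec_eq_zero h) hv hab (aeval_secondFormPoly F a a x ▸ ha)

end Field

theorem exists_sqrt_forall_aeval_asymptoticField_eq_zero {k : Type*} [Field k] [Infinite k]
    {F : MvPolynomial (Fin 3) k} {a b x v : Fin 3 → k} (hline : ∀ u : k, aeval (x + u • v) F = 0)
    (hv : v ≠ 0) (ha : aeval x (secondFormPoly F a a) ≠ 0)
    (hab : gradient F x ⬝ᵥ ((algebraMap k k ∘ a) ⨯₃ (algebraMap k k ∘ b)) ≠ 0) :
    ∃ e : k, e ^ 2 = aeval x (secondDiscPoly F a b) ∧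
      ∀ u : k, aeval (x + u • asymptoticField F a b x e) F = 0 := by
  have hrestrict := restrictLine_eq_zero_iff.2 hline
  have hva := dotProduct_ne_zero_of_restrictLine_eq_zero hrestrict hv ha hab
  obtain ⟨c, hc⟩ := exists_asymptoticField_eq_smul (b := b) hrestrict hva
  refine ⟨_, sq_eq_aeval_secondDiscPoly hrestrict hva, fun u => ?_⟩
  rw [hc, smul_smul]
  exact hline _

variable {k : Type u} [Field k] [IsAlgClosed k] [CharZero k] {F : MvPolynomial (Fin 3) k}
  {a b : Fin 3 → k}

theorem exists_ruledForm_of_forall_aeval_asymptoticField_eq_zero (hF : Irreducible F)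
    (H : ∀ (x : Fin 3 → k) (e : k), aeval x F = 0 → e ^ 2 = aeval x (secondDiscPoly F a b) →
      ∀ u : k, aeval (x + u • asymptoticField F a b x e) F = 0)
    {x v : Fin 3 → k} (hline : ∀ u : k, aeval (x + u • v) F = 0) (hv : v ≠ 0)
    (ha : aeval x (secondFormPoly F a a) ≠ 0)
    (hab : gradient F x ⬝ᵥ ((algebraMap k k ∘ a) ⨯₃ (algebraMap k k ∘ b)) ≠ 0)
    (hD : aeval x (secondDiscPoly F a b) ≠ 0) :
    ∃ Q : RuledForm k, Q.toPlaneMap.Parametrizes {x | aeval x F = 0} := by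
  have hrestrict := restrictLine_eq_zero_iff.2 hline
  have hva := dotProduct_ne_zero_of_restrictLine_eq_zero hrestrict hv ha hab
  let r := secondFormPoly F a b -
    C ((v ⬝ᵥ (algebraMap k k ∘ b)) / (v ⬝ᵥ (algebraMap k k ∘ a))) * secondFormPoly F a a
  have hr : ∀ y : Fin 3 → k, aeval y r = aeval y (secondFormPoly F a b) -
      (v ⬝ᵥ (algebraMap k k ∘ b)) / (v ⬝ᵥ (algebraMap k k ∘ a)) *
        aeval y (secondFormPoly F a a) := fun y => by
    simp only [r, map_sub, map_mul, aeval_C, Algebra.algebraMap_self_apply]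
  rw [aeval_secondFormPoly] at ha
  refine exists_ruledForm_of_forall_aeval_twoValuedField_eq_zero hF H hline (r := r)
    (fun u => ?_) ?_ fun u hu => ?_
  · rw [hr]
    exact sq_eq_aeval_secondDiscPoly (restrictLine_add_smul_eq_zero hrestrict u) hva
  · exact (asymptoticField_apply F a b x _).trans_ne (asymptoticDirection_ne_zero ha hab _)
  · replace hu : u • asymptoticField F a b x (-aeval x r) = v := hu
    obtain ⟨c, hc⟩ := exists_asymptoticField_eq_smul (b := b) hrestrict hva
    rw [← hr, ← hu, smul_smul, asymptoticField_apply, asymptoticField_apply] at hc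
    have hr0 : aeval x r = 0 := self_eq_neg.1 (eq_of_asymptoticDirection_eq_smul ha hab hc)
    rw [← sq_eq_aeval_secondDiscPoly hrestrict hva, ← hr, hr0] at hD
    exact hD (zero_pow two_ne_zero)

theorem exists_ruledForm_of_aeval_secondFormPoly_ne_zero (hF : Irreducible F) {P : PlaneMap k}
    (hP : IsGenericPoint F P.generic) (hruled : IsRuled {x : Fin 3 → k | aeval x F = 0})
    (ha : aeval P.generic (secondFormPoly F a a) ≠ 0)
    (hab : gradient F P.generic ⬝ᵥ
      ((algebraMap k (FunField k) ∘ a) ⨯₃ (algebraMap k (FunField k) ∘ b)) ≠ 0) :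
    ∃ Q : RuledForm k, Q.toPlaneMap.Parametrizes {x | aeval x F = 0} := by
  let δ : MvPolynomial (Fin 3) k := gradient F X ⬝ᵥ ((C ∘ a) ⨯₃ (C ∘ b))
  have hδ : aeval P.generic δ ≠ 0 := (aeval_gradient_dotProduct_cross F a b _).trans_ne hab
  have hsqrt : ∀ e : FunField k,
      (∀ u : k, aeval (P.generic + u • asymptoticField F a b P.generic e) F = 0) →
        ∃ Q : RuledForm k, Q.toPlaneMap.Parametrizes {x | aeval x F = 0} := fun e he => by
    refine exists_ruledForm_of_forall_aeval_eq_zero hF hP ?_ he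
    rw [asymptoticField_apply]
    exact asymptoticDirection_ne_zero (aeval_secondFormPoly F a a P.generic ▸ ha) hab e
  have hfield : ∀ x : Fin 3 → k, aeval x F = 0 → aeval x (secondFormPoly F a a * δ) ≠ 0 →
      ∃ e : k, e ^ 2 = aeval x (secondDiscPoly F a b) ∧
        ∀ u : k, aeval (x + u • asymptoticField F a b x e) F = 0 := fun x hx hne => by
    rw [map_mul, mul_ne_zero_iff, aeval_gradient_dotProduct_cross] at hne
    obtain ⟨v, hv, hline⟩ := hruled x hx
    exact exists_sqrt_forall_aeval_asymptoticField_eq_zero hline hv hne.1 hne.2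
  rcases hP.exists_sqrt_or_forall_aeval_twoValuedField_eq_zero hF
    (by rw [map_mul]; exact mul_ne_zero ha hδ) hfield with ⟨e, -, he⟩ | H
  · exact hsqrt e he
  by_cases hD : aeval P.generic (secondDiscPoly F a b) = 0
  · exact hsqrt 0 (H _ _ 0 ((hP F).2 dvd_rfl) (by rw [hD, zero_pow two_ne_zero]))
  · obtain ⟨s, t, hden, -, hne⟩ := P.exists_aeval_evalAt_ne_zero (h := 1)
      (G := secondFormPoly F a a * δ * secondDiscPoly F a b)
      (by simp only [map_mul]; exact mul_ne_zero (mul_ne_zero ha hδ) hD) one_ne_zero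
    simp only [δ, map_mul, mul_ne_zero_iff, aeval_gradient_dotProduct_cross] at hne
    obtain ⟨v, hv, hline⟩ := hruled (P.evalAt s t)
      (PlaneMap.aeval_evalAt_eq_zero ((hP F).2 dvd_rfl) hden)
    exact exists_ruledForm_of_forall_aeval_asymptoticField_eq_zero hF (H k) hline hv hne.1.1
      hne.1.2 hne.2

end AsymptoticRulings

section Constants

open MvPolynomial

theorem exists_derivation_algebraMap_eq {k A B : Type*} [CommRing k] [CommRing A] [CommRing B]
    [Algebra k A] [Algebra k B] [Algebra A B] [IsScalarTower k A B] [Algebra.FormallyEtale A B]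
    (D : Derivation k A A) :
    ∃ D' : Derivation k B B, ∀ x, D' (algebraMap A B x) = algebraMap A B (D x) := by
  let φ : KaehlerDifferential k B →ₗ[B] B :=
    (((Algebra.linearMap A B).compDer D).liftKaehlerDifferential.liftBaseChange B) ∘ₗ
      (KaehlerDifferential.tensorKaehlerEquivOfFormallyEtale k A B).symm.toLinearMap
  refine ⟨φ.compDer (KaehlerDifferential.D k B), fun x => ?_⟩
  simp [φ, KaehlerDifferential.tensorKaehlerEquivOfFormallyEtale_symm_D_algebraMap]

theorem mem_range_algebraMap_of_forall_derivation_eq_zero {k σ K : Type*} [Field k] [CharZero k]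
    [Field K] [Algebra k K] [Algebra (MvPolynomial σ k) K] [IsScalarTower k (MvPolynomial σ k) K]
    [IsFractionRing (MvPolynomial σ k) K] {f : K} (hf : ∀ D : Derivation k K K, D f = 0) :
    f ∈ Set.range (algebraMap k K) := by
  let A := MvPolynomial σ k
  obtain ⟨g, ⟨h, hmem⟩, hrel, rfl⟩ := IsFractionRing.exists_reduced_fraction A f
  have hh0 : algebraMap A K h ≠ 0 := IsFractionRing.to_map_ne_zero_of_mem_nonZeroDivisors hmem
  have : Algebra.FormallyEtale A K := .of_isLocalization (nonZeroDivisors A)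
  have hpderiv : ∀ i, g * pderiv i h = h * pderiv i g := fun i => by
    obtain ⟨D, hD⟩ := exists_derivation_algebraMap_eq (B := K) (pderiv i : Derivation k A A)
    have hDf := hf D
    rw [IsFractionRing.mk'_eq_div, Derivation.leibniz_div, hD, hD, smul_eq_zero_iff_right
      (pow_ne_zero 2 (inv_ne_zero hh0)), sub_eq_zero] at hDf
    apply IsFractionRing.injective A K
    rw [map_mul, map_mul]
    exact hDf.symm
  have hh : ∀ i, pderiv i h = 0 := fun i =>
    pderiv_eq_zero_of_dvd (hrel.symm.dvd_of_dvd_mul_left ⟨_, hpderiv i⟩)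
  have hg : ∀ i, pderiv i g = 0 := fun i => by
    have hi := hpderiv i
    rw [hh, mul_zero, zero_eq_mul] at hi
    exact hi.resolve_left (nonZeroDivisors.ne_zero hmem)
  have hC : ∀ c, algebraMap A K (C c) = algebraMap k K c := fun c =>
    (IsScalarTower.algebraMap_apply k A K c).symm
  refine ⟨g.coeff 0 / h.coeff 0, ?_⟩
  rw [map_div₀, IsFractionRing.mk'_eq_div, ← hC, ← hC, ← eq_C_of_forall_pderiv_eq_zero hg,
    ← eq_C_of_forall_pderiv_eq_zero hh]

end Constants

section FlatSurfaces

open MvPolynomial Matrix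

theorem cross_mulVec_eq_zero_of_secondForm_eq_zero {L : Type*} [Field L] {n w : Fin 3 → L}
    {H : Matrix (Fin 3) (Fin 3) L} (hn : n ≠ 0) (h : secondForm n H = 0) (hw : n ⬝ᵥ w = 0) :
    n ⨯₃ (H *ᵥ w) = 0 := by
  have hcross : ∀ b, n ⨯₃ (H *ᵥ (b ⨯₃ n)) = 0 := fun b => by
    refine dotProduct_eq_zero _ fun a => ?_
    rw [dotProduct_comm, triple_product_permutation, triple_product_permutation, dotProduct_comm,
      ← secondForm_apply, h, LinearMap.zero_apply, LinearMap.zero_apply]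
  obtain ⟨i, hi⟩ := Function.ne_iff.1 hn
  have hi' : n i • w = (Pi.single i 1 ⨯₃ w) ⨯₃ n := by
    rw [cross_cross_eq_smul_sub_smul, single_one_dotProduct, dotProduct_comm, hw, zero_smul,
      sub_zero]
  refine (smul_eq_zero.1 ?_).resolve_left hi
  rw [← map_smul, ← mulVec_smul, hi', hcross]

theorem gradient_dotProduct_derivation {k σ A : Type*} [CommRing k] [Fintype σ] [CommRing A]
    [Algebra k A] (D : Derivation k A A) (F : MvPolynomial σ k) (ξ : σ → A) :
    gradient F ξ ⬝ᵥ (D ∘ ξ) = D (aeval ξ F) :=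
  (derivation_aeval D ξ F).symm

theorem hessian_mulVec_derivation {k σ A : Type*} [CommRing k] [Fintype σ] [CommRing A]
    [Algebra k A] (D : Derivation k A A) (F : MvPolynomial σ k) (ξ : σ → A) :
    hessian F ξ *ᵥ (D ∘ ξ) = D ∘ gradient F ξ :=
  funext fun i => (derivation_aeval D ξ (pderiv i F)).symm

theorem exists_smul_gradient_eq_derivation {k L : Type*} [CommRing k] [Field L] [Algebra k L]
    {F : MvPolynomial (Fin 3) k} {ξ : Fin 3 → L} (hξ : aeval ξ F = 0) (hn : gradient F ξ ≠ 0)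
    (h : secondForm (gradient F ξ) (hessian F ξ) = 0) (D : Derivation k L L) :
    ∃ c : L, c • gradient F ξ = D ∘ gradient F ξ := by
  suffices hcross : gradient F ξ ⨯₃ (D ∘ gradient F ξ) = 0 by
    simpa only [hcross, ne_eq, not_true, false_iff, LinearIndependent.pair_iff' hn, not_forall,
      not_not] using crossProduct_ne_zero_iff_linearIndependent (v := gradient F ξ)
        (w := D ∘ gradient F ξ)
  rw [← hessian_mulVec_derivation]
  refine cross_mulVec_eq_zero_of_secondForm_eq_zero hn h ?_
  rw [gradient_dotProduct_derivation, hξ, map_zero]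

variable {k : Type u} [Field k] {F : MvPolynomial (Fin 3) k}

theorem IsGenericPoint.gradient_ne_zero [CharZero k] {L : Type*} [CommRing L] [Algebra k L]
    {σ : Type*} {F : MvPolynomial σ k} {ξ : σ → L} (hF : Irreducible F)
    (hξ : IsGenericPoint F ξ) : gradient F ξ ≠ 0 := by
  intro h
  have hpderiv : ∀ i, pderiv i F = 0 := fun i =>
    pderiv_eq_zero_of_dvd ((hξ _).1 (congrFun h i))
  have hC := eq_C_of_forall_pderiv_eq_zero hpderiv
  refine hF.not_isUnit ?_
  rw [hC, isUnit_map_iff, isUnit_iff_ne_zero]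
  rintro h0
  rw [h0, C_0] at hC
  exact hF.ne_zero hC

theorem exists_sum_C_mul_pderiv_eq_zero [CharZero k] {P : PlaneMap k} (hF : Irreducible F)
    (hP : IsGenericPoint F P.generic)
    (h : secondForm (gradient F P.generic) (hessian F P.generic) = 0) :
    ∃ v : Fin 3 → k, v ≠ 0 ∧ ∑ i, C (v i) * pderiv i F = 0 := by
  let n := gradient F P.generic
  have hn : n ≠ 0 := hP.gradient_ne_zero hF
  obtain ⟨i, hi⟩ := Function.ne_iff.1 hn
  obtain ⟨j, hj⟩ := exists_ne i
  have hratio : ∀ D : Derivation k (FunField k) (FunField k), D (n j / n i) = 0 := fun D => by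
    obtain ⟨c, hc⟩ := exists_smul_gradient_eq_derivation ((hP F).2 dvd_rfl) hn h D
    have hD : ∀ l, D (n l) = c * n l := fun l => (congrFun hc l).symm
    rw [Derivation.leibniz_div, hD, hD]
    simp only [smul_eq_mul]
    ring
  obtain ⟨c, hc⟩ := mem_range_algebraMap_of_forall_derivation_eq_zero (σ := Fin 2) hratio
  refine ⟨Pi.single j 1 - Pi.single i c, ?_, sum_C_mul_pderiv_eq_zero_of_dvd ((hP _).1 ?_)⟩
  · refine fun h0 => one_ne_zero (α := k) ?_
    simpa [hj] using congrFun h0 j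
  · rw [eq_div_iff hi] at hc
    simp only [Pi.sub_apply, Pi.single_apply, map_sub, sub_mul, apply_ite C, C_1, C_0, ite_mul,
      one_mul, zero_mul, Finset.sum_sub_distrib, Finset.sum_ite_eq', Finset.mem_univ, if_true,
      map_mul, algHom_C]
    exact sub_eq_zero.2 hc.symm

theorem exists_ruledForm_of_secondForm_eq_zero [IsAlgClosed k] [CharZero k] {P : PlaneMap k}
    (hF : Irreducible F) (hP : IsGenericPoint F P.generic)
    (h : secondForm (gradient F P.generic) (hessian F P.generic) = 0) :
    ∃ Q : RuledForm k, Q.toPlaneMap.Parametrizes {x | aeval x F = 0} := by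
  obtain ⟨v, hv, hsum⟩ := exists_sum_C_mul_pderiv_eq_zero hF hP h
  refine exists_ruledForm_of_forall_aeval_eq_zero hF hP (V := algebraMap k (FunField k) ∘ v)
    (fun h0 => hv (funext fun i => ?_)) fun u => ?_
  · exact (map_eq_zero _).1 (congrFun h0 i)
  · rw [← algebraMap_smul (FunField k) u, aeval_add_smul_of_sum_eq_zero hsum]
    exact (hP F).2 dvd_rfl

end FlatSurfaces

section RuledParametrization

open MvPolynomial Matrix

theorem algebraMap_comp_single_one {ι : Type*} [DecidableEq ι] (R : Type*) {A : Type*}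
    [CommSemiring R] [Semiring A] [Algebra R A] (i : ι) :
    algebraMap R A ∘ Pi.single i 1 = Pi.single i 1 := by
  ext j
  simp [Pi.single_apply, apply_ite (algebraMap R A)]

theorem secondForm_eq_zero_of_forall {k L : Type*} [Field k] [Field L] [CharZero L] [Algebra k L]
    {n : Fin 3 → L} {H : Matrix (Fin 3) (Fin 3) L} (hH : H.IsSymm)
    (h : ∀ a : Fin 3 → k, secondForm n H (algebraMap k L ∘ a) (algebraMap k L ∘ a) = 0) :
    secondForm n H = 0 := by
  have hpolar (a b : Fin 3 → k) :
      secondForm n H (algebraMap k L ∘ a) (algebraMap k L ∘ b) = 0 := by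
    have hab : algebraMap k L ∘ (a + b) = algebraMap k L ∘ a + algebraMap k L ∘ b :=
      funext fun i => map_add _ _ _
    have hsum := h (a + b)
    simp only [hab, map_add, LinearMap.add_apply, h, zero_add, add_zero] at hsum
    rwa [secondForm_comm n hH (algebraMap k L ∘ b), add_self_eq_zero] at hsum
  refine LinearMap.BilinForm.ext_basis (Pi.basisFun L (Fin 3)) fun i j => ?_
  rw [Pi.basisFun_apply, Pi.basisFun_apply, ← algebraMap_comp_single_one k i,
    ← algebraMap_comp_single_one k j, hpolar]
  rfl

variable {k : Type u} [Field k] [IsAlgClosed k] [CharZero k]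

theorem exists_ruledForm {F : MvPolynomial (Fin 3) k} (hF : Irreducible F) {P : PlaneMap k}
    (hP : IsGenericPoint F P.generic) (hruled : IsRuled {x : Fin 3 → k | aeval x F = 0}) :
    ∃ Q : RuledForm k, Q.toPlaneMap.Parametrizes {x | aeval x F = 0} := by
  by_cases! h : ∀ a : Fin 3 → k, aeval P.generic (secondFormPoly F a a) = 0
  · simp only [aeval_secondFormPoly] at h
    exact exists_ruledForm_of_secondForm_eq_zero hF hP
      (secondForm_eq_zero_of_forall (hessian_isSymm F _) h)
  · obtain ⟨a, ha⟩ := h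
    have hcross : gradient F P.generic ⨯₃ (algebraMap k (FunField k) ∘ a) ≠ 0 := fun h0 => by
      rw [aeval_secondFormPoly, secondForm_apply, ← cross_anticomm, h0, neg_zero,
        zero_dotProduct] at ha
      exact ha rfl
    obtain ⟨i, hi⟩ := Function.ne_iff.1 hcross
    refine exists_ruledForm_of_aeval_secondFormPoly_ne_zero (b := Pi.single i 1) hF hP hruled ha ?_
    rw [algebraMap_comp_single_one, triple_product_permutation, triple_product_permutation,
      single_one_dotProduct]
    exact hi

end RuledParametrization

end RuledSurface

theorem mainTheorem7 {k : Type*} [Field k] [IsAlgClosed k] [CharZero k]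
    (S : Set (Fin 3 → k)) (hS : RuledSurface.IsRationalRuledSurface S) :
    (∃ Q : RuledSurface.RuledForm k, Q.IsStandardized S) ∧
    ∀ P : RuledSurface.RuledForm k, P.toPlaneMap.Parametrizes S →
      ∃ Q : RuledSurface.RuledForm k, Q.IsStandardized S ∧
        RuledSurface.IsReparametrization Q.toPlaneMap P.toPlaneMap := by
  obtain ⟨F, hF, rfl⟩ := hS.surface
  obtain ⟨P₀, hP₀⟩ := hS.rational
  have hstandard (P : RuledSurface.RuledForm k) (hP : P.toPlaneMap.Parametrizes _) :=
    P.exists_isStandardized hP (P.exists_p_ne_zero hF hP)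
  obtain ⟨P, hP⟩ := RuledSurface.exists_ruledForm hF
    ((RuledSurface.PlaneMap.parametrizes_iff_isGenericPoint hF).1 hP₀) hS.ruled
  exact ⟨(hstandard P hP).imp fun Q hQ => hQ.1, hstandard⟩
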